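/- Let $\{a,b\}^*$ be the free monoid of words over $\{a,b\}$. A right ideal is a set $R\subseteq\{a,b\}^*$ with $R\cdot\{a,b\}^*\subseteq R$; it is finitely generated if $R=\Gamma\cdot\{a,b\}^*$ for a finite set $\Gamma$, and essential if it meets every non-empty right ideal. A right-ideal isomorphism is a bijection $\varphi\colon R_1\to R_2$ between right ideals with $\varphi(ux)=\varphi(u)x$ for all $u\in R_1$, $x\in\{a,b\}^*$; it is maximal if no right-ideal isomorphism strictly extends it. The Thompson group $V$ is the set of all maximal isomorphisms between finitely generated essential right ideals of $\{a,b\}^*$, where the product $\varphi\cdot\psi$ is the maximum extension of the composite $\varphi\circ\psi$ ($\psi$ is applied first). For a finite subset $\Delta$ of $V$ let $\Delta^{\pm1}$ be the alphabet that consists of the elements of $\Delta$ and their formal inverses, and let $$\mathrm{WP}_\Delta=\{\,w\in(\Delta^{\pm1})^* : \text{the product in } V \text{ of the letters of } w \text{ is the identity}\,\}.$$ For $T\colon\mathbb N\to\mathbb N$, a language is in $\mathrm{NTime}(T(n))$ if it is the set of words accepted by a nondeterministic multi-tape Turing machine all of whose computations on inputs of length $n$ have at most $C\cdot T(n)+C$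 steps, for some constant $C$; it is in $\mathrm{coNTime}(T(n))$ if its complement is in $\mathrm{NTime}(T(n))$; and it is in $\mathrm{DTime}(T(n))$ if the machine can be chosen deterministic. **Proposition.** For every finite set $\Delta$ of generators of $V$ (and, more generally, for every finite subset $\Delta\subseteq V$), the word problem $\mathrm{WP}_\Delta$ of $V$ is in $\mathrm{coNTime}(n)$, in $\mathrm{NTime}(n^2)$, and in $\mathrm{DTime}(n^3)$, where $n=|w|$ is the length of the input word $w$ over $\Delta^{\pm1}$. -/

import Mathlib

/-! ### Right ideals of the free monoid `{a, b}*` -/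

namespace Thompson

/-- Finite words over the two-letter alphabet `{a, b}`; the letters are `false` and `true`. -/
abbrev Word : Type := List Bool

/-- `R · A* ⊆ R`. -/
def IsRightIdeal (R : Set Word) : Prop :=
  ∀ u ∈ R, ∀ x : Word, u ++ x ∈ R

/-- A right ideal is essential if it meets every (non-empty) right ideal. -/
def IsEssentialRightIdeal (R : Set Word) : Prop :=
  IsRightIdeal R ∧ ∀ J : Set Word, IsRightIdeal J → J.Nonempty → (R ∩ J).Nonempty

/-- `R = Γ · A*` for some finite set `Γ` of words. -/
def IsFGRightIdeal (R : Set Word) : Prop :=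
  ∃ Γ : Set Word, Γ.Finite ∧ R = {w | ∃ p ∈ Γ, ∃ x : Word, w = p ++ x}

/-- The domain of a partial injection of `{a, b}*`. -/
def dom (f : Word ≃. Word) : Set Word := {u | ∃ v, v ∈ f u}

/-- The range of a partial injection of `{a, b}*`. -/
def ran (f : Word ≃. Word) : Set Word := {v | ∃ u, v ∈ f u}

/-- Right-ideal isomorphisms: partial injections whose domain and range are right ideals and
which satisfy `f (u x) = f u x` for all `u` in the domain and all words `x`. -/
structure IsRightIdealIso (f : Word ≃. Word) : Prop where
  dom_rightIdeal : IsRightIdeal (dom f)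
  ran_rightIdeal : IsRightIdeal (ran f)
  map_append : ∀ u v : Word, v ∈ f u → ∀ x : Word, v ++ x ∈ f (u ++ x)

/-- Isomorphisms between finitely generated essential right ideals. -/
structure IsFGEssentialIso (f : Word ≃. Word) : Prop extends IsRightIdealIso f where
  dom_essential : IsEssentialRightIdeal (dom f)
  ran_essential : IsEssentialRightIdeal (ran f)
  dom_fg : IsFGRightIdeal (dom f)
  ran_fg : IsFGRightIdeal (ran f)

/-- A right-ideal isomorphism is maximal if no right-ideal isomorphism strictly extends it
(`f ≤ g` says that the partial map `g` extends `f`). -/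
def IsMaximalIso (f : Word ≃. Word) : Prop :=
  IsRightIdealIso f ∧ ∀ g : Word ≃. Word, IsRightIdealIso g → f ≤ g → g = f

theorem IsRightIdealIso.of_map_append {f : Word ≃. Word}
    (h : ∀ u v : Word, v ∈ f u → ∀ x : Word, v ++ x ∈ f (u ++ x)) : IsRightIdealIso f where
  dom_rightIdeal := fun u ⟨v, hv⟩ x => ⟨v ++ x, h u v hv x⟩
  ran_rightIdeal := fun v ⟨u, hv⟩ x => ⟨u ++ x, h u v hv x⟩
  map_append := h

theorem IsEssentialRightIdeal.exists_append {R : Set Word} (h : IsEssentialRightIdeal R)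
    (u : Word) : ∃ x : Word, u ++ x ∈ R := by
  obtain ⟨w, hw, x, rfl⟩ := h.2 {w | ∃ x : Word, w = u ++ x}
    (by rintro _ ⟨x, rfl⟩ y; exact ⟨x ++ y, by simp⟩) ⟨u, [], by simp⟩
  exact ⟨x, hw⟩

theorem exists_length_of_fg {R : Set Word} (h : IsEssentialRightIdeal R) (hf : IsFGRightIdeal R) :
    ∃ n : ℕ, ∀ w : Word, n ≤ w.length → w ∈ R := by
  obtain ⟨Γ, hΓ, hR⟩ := hf
  obtain ⟨n, hn⟩ := (hΓ.image List.length).bddAbove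
  refine ⟨n, fun w hw => ?_⟩
  obtain ⟨x, hx⟩ := h.exists_append w
  rw [hR] at hx
  obtain ⟨p, hp, y, hy⟩ := hx
  have hpn : p.length ≤ n := hn ⟨p, hp, rfl⟩
  have hpw : p <+: w :=
    List.prefix_of_prefix_length_le ⟨y, hy.symm⟩ ⟨x, rfl⟩ (hpn.trans hw)
  obtain ⟨t, ht⟩ := hpw
  rw [hR]
  exact ⟨p, hp, t, ht.symm⟩

theorem essential_and_fg_of_length {R : Set Word} (hR : IsRightIdeal R) (n : ℕ)
    (h : ∀ w : Word, n ≤ w.length → w ∈ R) : IsEssentialRightIdeal R ∧ IsFGRightIdeal R := by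
  refine ⟨⟨hR, ?_⟩, ?_⟩
  · rintro J hJ ⟨u, hu⟩
    exact ⟨u ++ List.replicate n false, h _ (by simp), hJ u hu _⟩
  · refine ⟨{w | w.length ≤ n ∧ w ∈ R}, (List.finite_length_le Bool n).subset fun w hw => hw.1, ?_⟩
    ext w
    constructor
    · intro hw
      by_cases hl : w.length ≤ n
      · exact ⟨w, ⟨hl, hw⟩, [], by simp⟩
      · refine ⟨w.take n, ⟨by simp, h _ ?_⟩, w.drop n, by simp⟩
        simp; omega
    · rintro ⟨p, ⟨-, hp⟩, x, rfl⟩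
      exact hR p hp x

theorem dom_symm (f : Word ≃. Word) : dom f.symm = ran f := by
  ext u
  exact exists_congr fun v => f.mem_iff_mem

theorem ran_symm (f : Word ≃. Word) : ran f.symm = dom f := by
  ext u
  exact exists_congr fun v => f.mem_iff_mem

theorem IsRightIdealIso.symm {f : Word ≃. Word} (h : IsRightIdealIso f) :
    IsRightIdealIso f.symm :=
  .of_map_append fun u v huv x => by
    rw [← PEquiv.mem_iff_mem] at huv ⊢
    exact h.map_append _ _ huv x

theorem IsRightIdealIso.trans {f g : Word ≃. Word} (hf : IsRightIdealIso f)
    (hg : IsRightIdealIso g) : IsRightIdealIso (f.trans g) :=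
  .of_map_append fun u v huv x => by
    rw [PEquiv.mem_trans] at huv ⊢
    obtain ⟨w, h1, h2⟩ := huv
    exact ⟨w ++ x, hf.map_append _ _ h1 x, hg.map_append _ _ h2 x⟩

theorem IsFGEssentialIso.symm {f : Word ≃. Word} (h : IsFGEssentialIso f) :
    IsFGEssentialIso f.symm where
  toIsRightIdealIso := h.toIsRightIdealIso.symm
  dom_essential := by rw [dom_symm]; exact h.ran_essential
  ran_essential := by rw [ran_symm]; exact h.dom_essential
  dom_fg := by rw [dom_symm]; exact h.ran_fg
  ran_fg := by rw [ran_symm]; exact h.dom_fg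

theorem dom_trans_length {f g : Word ≃. Word} (hf : IsFGEssentialIso f)
    (hg : IsFGEssentialIso g) : ∃ n : ℕ, ∀ w : Word, n ≤ w.length → w ∈ dom (f.trans g) := by
  obtain ⟨m, hm⟩ := exists_length_of_fg hf.dom_essential hf.dom_fg
  obtain ⟨n, hn⟩ := exists_length_of_fg hg.dom_essential hg.dom_fg
  refine ⟨m + n, fun w hw => ?_⟩
  obtain ⟨v, hv⟩ := hm (w.take m) (by simp; omega)
  have h1 := hf.map_append _ _ hv (w.drop m)
  rw [List.take_append_drop] at h1
  obtain ⟨z, hz⟩ := hn (v ++ w.drop m) (by simp; omega)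
  exact ⟨z, (PEquiv.mem_trans f g w z).2 ⟨_, h1, hz⟩⟩

/-- The composite of two isomorphisms between finitely generated essential right ideals is again
one. -/
theorem IsFGEssentialIso.trans {f g : Word ≃. Word} (hf : IsFGEssentialIso f)
    (hg : IsFGEssentialIso g) : IsFGEssentialIso (f.trans g) := by
  have hi := hf.toIsRightIdealIso.trans hg.toIsRightIdealIso
  obtain ⟨m, hm⟩ := dom_trans_length hf hg
  obtain ⟨n, hn⟩ := dom_trans_length hg.symm hf.symm
  rw [← PEquiv.symm_trans_rev, dom_symm] at hn
  obtain ⟨h1, h2⟩ := essential_and_fg_of_length hi.dom_rightIdeal m hm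
  obtain ⟨h3, h4⟩ := essential_and_fg_of_length hi.ran_rightIdeal n hn
  exact ⟨hi, h1, h3, h2, h4⟩

/-- An extension of an isomorphism between finitely generated essential right ideals is again
one. -/
theorem IsFGEssentialIso.of_le {f g : Word ≃. Word} (hf : IsFGEssentialIso f)
    (hg : IsRightIdealIso g) (h : f ≤ g) : IsFGEssentialIso g := by
  obtain ⟨m, hm⟩ := exists_length_of_fg hf.dom_essential hf.dom_fg
  obtain ⟨n, hn⟩ := exists_length_of_fg hf.ran_essential hf.ran_fg
  obtain ⟨h1, h2⟩ := essential_and_fg_of_length hg.dom_rightIdeal m fun w hw => by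
    obtain ⟨v, hv⟩ := hm w hw
    exact ⟨v, h _ _ hv⟩
  obtain ⟨h3, h4⟩ := essential_and_fg_of_length hg.ran_rightIdeal n fun w hw => by
    obtain ⟨v, hv⟩ := hn w hw
    exact ⟨v, h _ _ hv⟩
  exact ⟨hg, h1, h3, h2, h4⟩

/-! ### The maximum extension -/

/-- `v` is the value at `u` of some right-ideal isomorphism extending `f`. -/
def ExtRel (f : Word ≃. Word) (u v : Word) : Prop :=
  ∃ g : Word ≃. Word, IsRightIdealIso g ∧ f ≤ g ∧ v ∈ g u

theorem ExtRel.right_unique {f : Word ≃. Word} (hf : IsFGEssentialIso f) {u v v' : Word}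
    (h : ExtRel f u v) (h' : ExtRel f u v') : v = v' := by
  obtain ⟨g, hg, hle, hv⟩ := h
  obtain ⟨g', hg', hle', hv'⟩ := h'
  obtain ⟨x, w, hw⟩ := hf.dom_essential.exists_append u
  have h1 := Option.mem_unique (hg.map_append _ _ hv x) (hle _ _ hw)
  have h2 := Option.mem_unique (hg'.map_append _ _ hv' x) (hle' _ _ hw)
  exact List.append_cancel_right (h1.trans h2.symm)

theorem ExtRel.left_unique {f : Word ≃. Word} (hf : IsFGEssentialIso f) {u u' v : Word}
    (h : ExtRel f u v) (h' : ExtRel f u' v) : u = u' := by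
  obtain ⟨g, hg, hle, hv⟩ := h
  obtain ⟨g', hg', hle', hv'⟩ := h'
  obtain ⟨x, w, hw⟩ := hf.ran_essential.exists_append v
  have h1 := g.inj (hg.map_append _ _ hv x) (hle _ _ hw)
  have h2 := g'.inj (hg'.map_append _ _ hv' x) (hle' _ _ hw)
  exact List.append_cancel_right (h1.trans h2.symm)

open Classical in
/-- The maximum extension of `f`: the union of all right-ideal isomorphisms that extend `f`. -/
noncomputable def maxExt (f : Word ≃. Word) (hf : IsFGEssentialIso f) : Word ≃. Word where
  toFun u := if h : ∃ v, ExtRel f u v then some h.choose else none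
  invFun v := if h : ∃ u, ExtRel f u v then some h.choose else none
  inv u v := by
    constructor
    · intro h
      split_ifs at h with h1
      · have h2 : ExtRel f u v := Option.some.inj h ▸ h1.choose_spec
        have h3 : ∃ v, ExtRel f u v := ⟨v, h2⟩
        rw [dif_pos h3]
        exact congrArg some (ExtRel.right_unique hf h3.choose_spec h2)
    · intro h
      split_ifs at h with h1
      · have h2 : ExtRel f u v := Option.some.inj h ▸ h1.choose_spec
        have h3 : ∃ u, ExtRel f u v := ⟨u, h2⟩
        rw [dif_pos h3]
        exact congrArg some (ExtRel.left_unique hf h3.choose_spec h2)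

open Classical in
theorem mem_maxExt {f : Word ≃. Word} (hf : IsFGEssentialIso f) {u v : Word} :
    v ∈ maxExt f hf u ↔ ExtRel f u v := by
  change (v ∈ if h : ∃ v, ExtRel f u v then some h.choose else none) ↔ _
  constructor
  · intro h
    split_ifs at h with h1
    · exact Option.some.inj h ▸ h1.choose_spec
    · cases h
  · intro h
    have h3 : ∃ v, ExtRel f u v := ⟨v, h⟩
    rw [dif_pos h3]
    exact congrArg some (ExtRel.right_unique hf h3.choose_spec h)

theorem le_maxExt_of_le {f g : Word ≃. Word} (hf : IsFGEssentialIso f) (hg : IsRightIdealIso g)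
    (h : f ≤ g) : g ≤ maxExt f hf :=
  fun _ _ hv => (mem_maxExt hf).2 ⟨g, hg, h, hv⟩

theorem isRightIdealIso_maxExt {f : Word ≃. Word} (hf : IsFGEssentialIso f) :
    IsRightIdealIso (maxExt f hf) :=
  .of_map_append fun u v h x => by
    rw [mem_maxExt] at h ⊢
    obtain ⟨g, hg, hle, hv⟩ := h
    exact ⟨g, hg, hle, hg.map_append _ _ hv x⟩

theorem le_maxExt {f : Word ≃. Word} (hf : IsFGEssentialIso f) : f ≤ maxExt f hf :=
  le_maxExt_of_le hf hf.toIsRightIdealIso le_rfl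

theorem isMaximalIso_maxExt {f : Word ≃. Word} (hf : IsFGEssentialIso f) :
    IsMaximalIso (maxExt f hf) :=
  ⟨isRightIdealIso_maxExt hf, fun _ hg h =>
    le_antisymm (le_maxExt_of_le hf hg ((le_maxExt hf).trans h)) h⟩

theorem maxExt_eq_of_le {f g : Word ≃. Word} (hf : IsFGEssentialIso f) (hg : IsFGEssentialIso g)
    (h : f ≤ g) : maxExt f hf = maxExt g hg :=
  le_antisymm
    (le_maxExt_of_le hg (isRightIdealIso_maxExt hf)
      (le_maxExt_of_le hf hg.toIsRightIdealIso h))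
    (le_maxExt_of_le hf (isRightIdealIso_maxExt hg) (h.trans (le_maxExt hg)))

theorem maxExt_eq_self {f : Word ≃. Word} (hf : IsFGEssentialIso f) (hm : IsMaximalIso f) :
    maxExt f hf = f :=
  hm.2 _ (isRightIdealIso_maxExt hf) (le_maxExt hf)

theorem trans_le_trans {f f' g g' : Word ≃. Word} (hf : f ≤ f') (hg : g ≤ g') :
    f.trans g ≤ f'.trans g' := by
  intro u v h
  rw [PEquiv.mem_trans] at h ⊢
  obtain ⟨w, h1, h2⟩ := h
  exact ⟨w, hf _ _ h1, hg _ _ h2⟩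

theorem isFGEssentialIso_refl : IsFGEssentialIso (PEquiv.refl Word) := by
  have hi : IsRightIdealIso (PEquiv.refl Word) :=
    .of_map_append fun u v h x => by simp_all
  obtain ⟨h1, h2⟩ := essential_and_fg_of_length hi.dom_rightIdeal 0
    fun w _ => (⟨w, by simp⟩ : w ∈ dom (PEquiv.refl Word))
  obtain ⟨h3, h4⟩ := essential_and_fg_of_length hi.ran_rightIdeal 0
    fun w _ => (⟨w, by simp⟩ : w ∈ ran (PEquiv.refl Word))
  exact ⟨hi, h1, h3, h2, h4⟩

theorem isMaximalIso_refl : IsMaximalIso (PEquiv.refl Word) := by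
  refine ⟨isFGEssentialIso_refl.toIsRightIdealIso, fun g _ h => ?_⟩
  refine le_antisymm (fun u v hv => ?_) h
  have := Option.mem_unique hv (h u u (by simp))
  simp [this]

theorem IsMaximalIso.symm {f : Word ≃. Word} (hf : IsMaximalIso f) : IsMaximalIso f.symm := by
  refine ⟨hf.1.symm, fun g hg h => ?_⟩
  have : g.symm = f := hf.2 _ hg.symm fun u v hv => by
    rw [← PEquiv.mem_iff_mem]
    exact h _ _ (PEquiv.mem_iff_mem f |>.2 hv)
  rw [← this, PEquiv.symm_symm]

theorem trans_symm_le_refl (f : Word ≃. Word) : f.trans f.symm ≤ PEquiv.refl Word := by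
  intro u v h
  rw [PEquiv.mem_trans] at h
  obtain ⟨w, h1, h2⟩ := h
  rw [← PEquiv.mem_iff_mem] at h2
  rw [f.inj h1 h2]
  simp

/-! ### The Thompson group `V` -/

/-- The elements of the Thompson group `V`: the maximal isomorphisms between finitely generated
essential right ideals of `{a, b}*`. -/
structure V where
  toPEquiv : Word ≃. Word
  isFGEssentialIso : IsFGEssentialIso toPEquiv
  isMaximalIso : IsMaximalIso toPEquiv

@[ext]
theorem V.ext {φ ψ : V} (h : φ.toPEquiv = ψ.toPEquiv) : φ = ψ := by
  cases φ; cases ψ; cases h; rfl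

/-- The maximum extension, as an element of `V`. -/
noncomputable def V.ofIso (f : Word ≃. Word) (hf : IsFGEssentialIso f) : V where
  toPEquiv := maxExt f hf
  isFGEssentialIso := hf.of_le (isRightIdealIso_maxExt hf) (le_maxExt hf)
  isMaximalIso := isMaximalIso_maxExt hf

theorem V.ofIso_eq_of_le {f g : Word ≃. Word} (hf : IsFGEssentialIso f) (hg : IsFGEssentialIso g)
    (h : f ≤ g) : V.ofIso f hf = V.ofIso g hg :=
  V.ext (maxExt_eq_of_le hf hg h)

/-- The product `φ · ψ` is the maximum extension of `φ ∘ ψ` (`ψ` is applied first). -/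
noncomputable instance : Mul V where
  mul φ ψ := V.ofIso (ψ.toPEquiv.trans φ.toPEquiv) (ψ.isFGEssentialIso.trans φ.isFGEssentialIso)

/-- The identity map on `{a, b}*`. -/
noncomputable instance : One V where
  one := ⟨PEquiv.refl Word, isFGEssentialIso_refl, isMaximalIso_refl⟩

noncomputable instance : Inv V where
  inv φ := ⟨φ.toPEquiv.symm, φ.isFGEssentialIso.symm, φ.isMaximalIso.symm⟩

theorem V.mul_def (φ ψ : V) : φ * ψ = V.ofIso (ψ.toPEquiv.trans φ.toPEquiv)
    (ψ.isFGEssentialIso.trans φ.isFGEssentialIso) := rfl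

theorem V.ofIso_toPEquiv (φ : V) : V.ofIso φ.toPEquiv φ.isFGEssentialIso = φ :=
  V.ext (maxExt_eq_self φ.isFGEssentialIso φ.isMaximalIso)

noncomputable instance : Group V :=
  Group.ofLeftAxioms
    (by
      intro φ ψ ρ
      have h := ρ.isFGEssentialIso.trans (ψ.isFGEssentialIso.trans φ.isFGEssentialIso)
      trans V.ofIso _ h
      · exact (V.ofIso_eq_of_le h (ρ.isFGEssentialIso.trans (φ * ψ).isFGEssentialIso)
          (trans_le_trans le_rfl
            (le_maxExt (ψ.isFGEssentialIso.trans φ.isFGEssentialIso)))).symm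
      · refine V.ofIso_eq_of_le h ((ψ * ρ).isFGEssentialIso.trans φ.isFGEssentialIso) ?_
        rw [← PEquiv.trans_assoc]
        exact trans_le_trans (le_maxExt (ρ.isFGEssentialIso.trans ψ.isFGEssentialIso)) le_rfl)
    (by
      intro φ
      conv_rhs => rw [← V.ofIso_toPEquiv φ]
      exact V.ofIso_eq_of_le _ _ (PEquiv.trans_refl φ.toPEquiv).le)
    (by
      intro φ
      conv_rhs => rw [← V.ofIso_toPEquiv 1]
      exact V.ofIso_eq_of_le _ _ (trans_symm_le_refl φ.toPEquiv))

end Thompson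

/-! ### Multi-tape Turing machines and time complexity classes -/

namespace TimeComplexity

/-- A nondeterministic Turing machine with input alphabet `Γ`. It has an input tape (tape `0`,
which may be written on) and `workTapes` further tapes; all tapes are infinite in both directions.
A tape cell holds an input letter, an auxiliary letter, or the blank `none`. Depending on the state
and on the scanned letters, one step chooses a new state and, on every tape, a letter to be written
and a move of the head (`none`: the head does not move). -/
structure Machine (Γ : Type) where
  workTapes : ℕ
  State : Type
  stateFintype : Fintype State
  Aux : Type
  auxFintype : Fintype Aux
  start : State
  accept : Set State
  trans : State → (Fin (workTapes + 1) → Option (Γ ⊕ Aux)) →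
    Set (State × (Fin (workTapes + 1) → Option (Γ ⊕ Aux) × Option Turing.Dir))

namespace Machine

variable {Γ : Type} (M : Machine Γ)

/-- The contents of a tape cell. -/
abbrev Cell : Type := Option (Γ ⊕ M.Aux)

/-- A configuration: the state and the tapes with their head positions. -/
structure Cfg where
  state : M.State
  tape : Fin (M.workTapes + 1) → Turing.Tape M.Cell

/-- Write a letter on a tape, then move its head. -/
def writeMove (T : Turing.Tape M.Cell) (p : M.Cell × Option Turing.Dir) : Turing.Tape M.Cell :=
  match p.2 with
  | none => T.write p.1
  | some d => (T.write p.1).move d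

/-- The initial configuration: the input is written on tape `0`, with the head on its first letter,
and the other tapes are blank. -/
def init (w : List Γ) : M.Cfg where
  state := M.start
  tape i := if i = 0 then Turing.Tape.mk₁ (w.map fun a => some (Sum.inl a)) else Turing.Tape.mk₁ []

/-- One step of a computation. -/
def Step (c c' : M.Cfg) : Prop :=
  ∃ r ∈ M.trans c.state (fun i => (c.tape i).head),
    c' = ⟨r.1, fun i => M.writeMove (c.tape i) (r.2 i)⟩

/-- `M.Computes t c c'`: some computation leads from `c` to `c'` in exactly `t` steps. -/
inductive Computes : ℕ → M.Cfg → M.Cfg → Prop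
  | zero (c : M.Cfg) : Computes 0 c c
  | succ {t : ℕ} {c c' c'' : M.Cfg} : Computes t c c' → M.Step c' c'' → Computes (t + 1) c c''

/-- No step is possible. -/
def Halted (c : M.Cfg) : Prop := ∀ c', ¬ M.Step c c'

/-- The input `w` is accepted if some computation on `w` halts in an accepting state. -/
def Accepts (w : List Γ) : Prop :=
  ∃ t c, M.Computes t (M.init w) c ∧ M.Halted c ∧ c.state ∈ M.accept

/-- Every computation on every input `w` has at most `T |w|` steps. -/
def RunsInTime (T : ℕ → ℕ) : Prop :=
  ∀ w t c, M.Computes t (M.init w) c → t ≤ T w.length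

/-- At most one step is possible in every situation. -/
def Deterministic : Prop := ∀ q s, (M.trans q s).Subsingleton

end Machine

/-- The languages that are accepted by a nondeterministic multi-tape Turing machine all of whose
computations have `O(T(n))` steps on inputs of length `n`. (The additive constant covers the
inputs of length `n` with `T(n) = 0`, such as the empty word.) -/
def NTime {Γ : Type} (T : ℕ → ℕ) : Set (Set (List Γ)) :=
  {L | ∃ (M : Machine Γ) (C : ℕ), M.RunsInTime (fun n => C * T n + C) ∧ ∀ w, w ∈ L ↔ M.Accepts w}

/-- The languages whose complement is in `NTime T`. -/
def coNTime {Γ : Type} (T : ℕ → ℕ) : Set (Set (List Γ)) :=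
  {L | Lᶜ ∈ NTime T}

/-- The languages that are decided by a deterministic multi-tape Turing machine in `O(T(n))`
steps on inputs of length `n`. -/
def DTime {Γ : Type} (T : ℕ → ℕ) : Set (Set (List Γ)) :=
  {L | ∃ (M : Machine Γ) (C : ℕ), M.Deterministic ∧ M.RunsInTime (fun n => C * T n + C) ∧
    ∀ w, w ∈ L ↔ M.Accepts w}

end TimeComplexity

/-! ### Word problems -/

/-- The letter `(x, true)` of the alphabet `Δ^{±1}` stands for `x`, and `(x, false)` for `x⁻¹`. -/
def letterValue {G : Type} [Group G] {Δ : Finset G} (a : Δ × Bool) : G :=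
  if a.2 then (a.1 : G) else (a.1 : G)⁻¹

/-- The word problem of `G` over the finite set `Δ ⊆ G`: all words over the alphabet `Δ^{±1}` whose
product is the identity of `G`. -/
def wordProblem {G : Type} [Group G] (Δ : Finset G) : Set (List (Δ × Bool)) :=
  {w | (w.map letterValue).prod = 1}

namespace Thompson

/-! ### Minimal words of the domain of a right-ideal isomorphism -/

/-! Maximal extension is irrelevant for deciding triviality: the plain composite `g` of the tables
of the letters represents the identity of `V` iff it fixes every word of its domain. Since `g`
commutes with right multiplication, it is enough to test the prefix code `minDom g` that generates
the domain.

Two linear bounds make this fast. For an input of length `n`, every code word has length at most `K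
* n`, because each letter inspects at most `K` symbols of its argument
(`IsTable.length_le_of_noProperPrefix_comp`). The code has at most `D * n + 1` words, because code
sizes are subadditive under composition (`encard_minDom_trans_le`).

One pass of a machine applies the maps in turn to a word produced lazily: a symbol is added to the
guess only if the next map is not yet defined. The completed guess is therefore always a code word,
and its image stands on a stack, to be compared with it in linear time (`within_pass`). Guessing the
symbols nondeterministically and accepting upon a difference recognises the complement in linear
time. Running through the code by depth-first search takes linearly many passes (`within_search`),
so the word problem is even in deterministic time `n ^ 2`; this yields both the `NTime` and the
`DTime` claim. -/

/-- No proper prefix of `u` is in the domain of `g`. -/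
def NoProperPrefix (g : Word ≃. Word) (u : Word) : Prop :=
  ∀ v, v <+: u → v ∈ dom g → v = u

/-- The prefix code that generates the domain of `g`. -/
def minDom (g : Word ≃. Word) : Set Word := {u | u ∈ dom g ∧ NoProperPrefix g u}

theorem NoProperPrefix.concat {g : Word ≃. Word} {u : Word} (h : NoProperPrefix g u)
    (hu : u ∉ dom g) (b : Bool) : NoProperPrefix g (u ++ [b]) := by
  intro v hv hd
  rcases List.prefix_concat_iff.1 hv with rfl | hv
  · rfl
  · exact absurd (h v hv hd ▸ hd) hu

theorem noProperPrefix_nil (g : Word ≃. Word) : NoProperPrefix g [] :=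
  fun _ hv _ => List.prefix_nil.1 hv

/-- A proper prefix of `q ++ [c]` is a prefix of `q`, hence a proper prefix of `u`. This makes the
next guess of the search admissible. -/
theorem NoProperPrefix.of_prefix {g : Word ≃. Word} {q u : Word} {b c : Bool}
    (h : NoProperPrefix g u) (hq : q ++ [b] <+: u) : NoProperPrefix g (q ++ [c]) := by
  intro v hv hd
  rcases List.prefix_concat_iff.1 hv with rfl | hv
  · rfl
  · have h1 := h v (hv.trans ((List.prefix_append q [b]).trans hq)) hd
    subst h1
    have := (hq.trans hv).length_le
    simp at this

theorem exists_prefix_mem_minDom {g : Word ≃. Word} {u : Word} (hu : u ∈ dom g) :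
    ∃ p ∈ minDom g, p <+: u := by
  classical
  have h : ∃ n, u.take n ∈ dom g := ⟨u.length, by simpa using hu⟩
  refine ⟨u.take (Nat.find h), ⟨Nat.find_spec h, fun v hv hd => ?_⟩, List.take_prefix _ _⟩
  have hvu := hv.trans (List.take_prefix _ _)
  have h1 : u.take v.length = v := (List.prefix_iff_eq_take.1 hvu).symm
  have h2 := Nat.find_min' h (h1.symm ▸ hd)
  exact hv.eq_of_length_le ((List.length_take_le _ _).trans h2)

/-- If a minimal word `u` of the composite is not minimal for `f`, then `f` is already defined on
`u` without its last letter, so `f` carries that letter along unchanged. A proper prefix of `f u` in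
the domain of `g` would then make `u` non-minimal. The default `[]` plays no role, since `f.symm` is
defined at the relevant words. -/
theorem minDom_trans_subset {f g : Word ≃. Word} (hf : IsRightIdealIso f)
    (hg : IsRightIdealIso g) :
    minDom (f.trans g) ⊆ minDom f ∪ (fun v => (f.symm v).getD []) '' minDom g := by
  rintro u ⟨⟨z, hz⟩, hmin⟩
  obtain ⟨v, hv, hvz⟩ := (PEquiv.mem_trans f g u z).1 hz
  by_cases hu : NoProperPrefix f u
  · exact Or.inl ⟨⟨v, hv⟩, hu⟩
  · right
    refine ⟨v, ⟨⟨z, hvz⟩, ?_⟩, ?_⟩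
    · simp only [NoProperPrefix, not_forall] at hu
      obtain ⟨p, ⟨t, rfl⟩, ⟨q, hq⟩, hne⟩ := hu
      have ht : t ≠ [] := by rintro rfl; simp at hne
      obtain ⟨t, b, rfl⟩ := List.eq_nil_or_concat t |>.resolve_left ht
      rw [List.concat_eq_append, ← List.append_assoc] at hmin hv
      have h1 := hf.map_append _ _ hq t
      have h2 := hf.map_append _ _ h1 [b]
      obtain rfl := Option.mem_unique h2 hv
      intro w hw hd
      rcases List.prefix_concat_iff.1 hw with rfl | ⟨x, hx⟩
      · rfl
      · obtain ⟨y, hy⟩ := hd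
        have h3 := hg.map_append _ _ hy x
        rw [hx] at h3
        have := hmin (p ++ t) (List.prefix_append _ _)
          ⟨_, (PEquiv.mem_trans f g _ _).2 ⟨_, h1, h3⟩⟩
        simp at this
    · change (f.symm v).getD [] = u
      rw [Option.mem_def.1 ((PEquiv.mem_iff_mem f).2 hv)]
      rfl

theorem encard_minDom_trans_le {f g : Word ≃. Word} (hf : IsRightIdealIso f)
    (hg : IsRightIdealIso g) :
    (minDom (f.trans g)).encard ≤ (minDom f).encard + (minDom g).encard :=
  (Set.encard_le_encard (minDom_trans_subset hf hg)).trans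
    ((Set.encard_union_le _ _).trans (add_le_add le_rfl (Set.encard_image_le _ _)))

theorem minDom_refl : minDom (PEquiv.refl Word) ⊆ {[]} := by
  rintro u ⟨-, hu⟩
  exact (hu [] List.nil_prefix ⟨[], by simp⟩).symm

theorem length_le_of_noProperPrefix {g : Word ≃. Word} {n : ℕ}
    (hg : ∀ u : Word, n ≤ u.length → u ∈ dom g) {u : Word} (hu : NoProperPrefix g u) :
    u.length ≤ n := by
  by_contra! h
  have := congrArg List.length (hu (u.take n) (List.take_prefix _ _) (hg _ (by simp; omega)))
  simp at this
  omega

/-! ### Composites of finitely many isomorphisms -/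

variable {Γ : Type}

/-- The composite of the maps `f a`, where `a` runs through the letters of a word; the map of the
first letter is applied first. -/
def comp (f : Γ → Word ≃. Word) : List Γ → (Word ≃. Word)
  | [] => PEquiv.refl Word
  | a :: w => (f a).trans (comp f w)

theorem comp_append (f : Γ → Word ≃. Word) (w w' : List Γ) :
    comp f (w ++ w') = (comp f w).trans (comp f w') := by
  induction w with
  | nil => simp [comp]
  | cons a w ih => simp [comp, ih, PEquiv.trans_assoc]

/-- Length bounds for the tables of a family of right-ideal isomorphisms. -/
structure IsTable (f : Γ → Word ≃. Word) (K B : ℕ) : Prop where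
  iso : ∀ a, IsRightIdealIso (f a)
  mem_dom : ∀ a (u : Word), K ≤ u.length → u ∈ dom (f a)
  le : K ≤ B
  length_le : ∀ a (u v : Word), u.length ≤ K → v ∈ f a u → v.length ≤ B

/-- Finitely many maps, and finitely many arguments of length at most `K`, give uniform bounds.
Requiring `K ≤ B` lets words of length at most `B` store both arguments and values. -/
theorem exists_isTable [Finite Γ] {f : Γ → Word ≃. Word} (hf : ∀ a, IsFGEssentialIso (f a)) :
    ∃ K B, IsTable f K B := by
  choose n hn using fun a => exists_length_of_fg (hf a).dom_essential (hf a).dom_fg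
  obtain ⟨K, hK⟩ := (Set.finite_range n).bddAbove
  have hfin : (Set.range fun p : Γ × {u : Word // u.length ≤ K} =>
      ((f p.1 p.2.1).getD []).length).Finite := by
    have : Finite {u : Word // u.length ≤ K} := List.finite_length_le Bool K
    exact Set.finite_range _
  obtain ⟨B, hB⟩ := hfin.bddAbove
  refine ⟨K, max K B, fun a => (hf a).toIsRightIdealIso,
    fun a u hu => hn a u (le_trans (hK ⟨a, rfl⟩) hu), le_max_left _ _, fun a u v hu hv => ?_⟩
  refine le_trans (hB ⟨(a, ⟨u, hu⟩), ?_⟩) (le_max_right _ _)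
  simp [Option.mem_def.1 hv]

namespace IsTable

variable {f : Γ → Word ≃. Word} {K B : ℕ}

theorem comp_iso (h : IsTable f K B) (w : List Γ) : IsRightIdealIso (comp f w) := by
  induction w with
  | nil => exact isFGEssentialIso_refl.toIsRightIdealIso
  | cons a w ih => exact (h.iso a).trans ih

/-- Each map acts on the first `K` letters and copies the rest, so every letter of `w` uses up at
most `K` letters of `u`. -/
theorem mem_dom_comp (h : IsTable f K B) (w : List Γ) (u : Word) (hu : K * w.length ≤ u.length) :
    u ∈ dom (comp f w) := by
  induction w generalizing u with
  | nil => exact ⟨u, by simp [comp]⟩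
  | cons a w ih =>
    rw [List.length_cons, mul_add, mul_one] at hu
    obtain ⟨v, hv⟩ := h.mem_dom a (u.take K) (by simp; omega)
    have h1 := (h.iso a).map_append _ _ hv (u.drop K)
    rw [List.take_append_drop] at h1
    obtain ⟨z, hz⟩ := ih (v ++ u.drop K) (by simp; omega)
    exact ⟨z, (PEquiv.mem_trans _ _ _ _).2 ⟨_, h1, hz⟩⟩

theorem length_le_of_noProperPrefix_comp (h : IsTable f K B) {w : List Γ} {u : Word}
    (hu : NoProperPrefix (comp f w) u) : u.length ≤ K * w.length :=
  length_le_of_noProperPrefix (h.mem_dom_comp w) hu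

/-- By subadditivity each letter contributes at most `D`, the largest code size in the table, and
the final identity map contributes the summand `1`. -/
theorem exists_encard_minDom_comp_le [Finite Γ] (h : IsTable f K B) :
    ∃ D : ℕ, ∀ w, (minDom (comp f w)).encard ≤ ((D * w.length + 1 : ℕ) : ℕ∞) := by
  have hfin : ∀ a, (minDom (f a)).Finite := fun a =>
    (List.finite_length_le Bool K).subset fun u hu =>
      length_le_of_noProperPrefix (h.mem_dom a) hu.2
  obtain ⟨D, hD⟩ := (Set.finite_range fun a => (minDom (f a)).ncard).bddAbove
  refine ⟨D, fun w => ?_⟩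
  induction w with
  | nil =>
    refine (Set.encard_le_encard minDom_refl).trans ?_
    simp
  | cons a w ih =>
    refine (encard_minDom_trans_le (h.iso a) (h.comp_iso w)).trans ?_
    have h1 : (minDom (f a)).encard ≤ (D : ℕ∞) := by
      rw [← (hfin a).cast_ncard_eq]
      exact_mod_cast hD ⟨a, rfl⟩
    refine (add_le_add h1 ih).trans ?_
    norm_cast
    rw [List.length_cons, mul_add]
    omega

end IsTable

/-! ### The word problem in terms of composites -/

/-- A map that fixes its domain pointwise is a restriction of the identity, and a map and its
extension have the same maximum extension. -/
theorem V.ofIso_eq_one_iff {g : Word ≃. Word} (hg : IsFGEssentialIso g) :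
    V.ofIso g hg = 1 ↔ ∀ u v, v ∈ g u → v = u := by
  constructor
  · intro h u v hv
    have h1 : v ∈ maxExt g hg u := le_maxExt hg u v hv
    have h2 : maxExt g hg = PEquiv.refl Word := congrArg V.toPEquiv h
    rw [h2] at h1
    simpa using h1.symm
  · intro h
    rw [V.ofIso_eq_of_le hg isFGEssentialIso_refl fun u v hv => by simp [h u v hv]]
    exact V.ofIso_toPEquiv 1

theorem comp_isFGEssentialIso {f : Γ → Word ≃. Word} (hf : ∀ a, IsFGEssentialIso (f a))
    (w : List Γ) : IsFGEssentialIso (comp f w) := by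
  induction w with
  | nil => exact isFGEssentialIso_refl
  | cons a w ih => exact (hf a).trans ih

/-- The product in `V` applies the last letter first, whereas `comp` reads from the left. Inverting
every letter reverses the order, so the input can be scanned from left to right. -/
theorem ofIso_comp_eq (x : Γ → V) (w : List Γ) :
    V.ofIso (comp (fun a => (x a)⁻¹.toPEquiv) w)
      (comp_isFGEssentialIso (fun a => (x a)⁻¹.isFGEssentialIso) w) = (w.map x).prod⁻¹ := by
  induction w with
  | nil =>
    rw [List.map_nil, List.prod_nil, inv_one]
    exact V.ofIso_toPEquiv 1
  | cons a w ih =>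
    rw [List.map_cons, List.prod_cons, mul_inv_rev, ← ih]
    have h := comp_isFGEssentialIso (fun a => (x a)⁻¹.isFGEssentialIso) w
    exact V.ofIso_eq_of_le _ ((x a)⁻¹.isFGEssentialIso.trans (V.ofIso _ h).isFGEssentialIso)
      (trans_le_trans le_rfl (le_maxExt h))

theorem mem_wordProblem_iff (Δ : Finset V) (w : List (Δ × Bool)) :
    w ∈ wordProblem Δ ↔
      ∀ u v, v ∈ comp (fun a : Δ × Bool => (letterValue a)⁻¹.toPEquiv) w u → v = u := by
  rw [← V.ofIso_eq_one_iff
    (comp_isFGEssentialIso (fun a : Δ × Bool => (letterValue a)⁻¹.isFGEssentialIso) w),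
    ofIso_comp_eq, inv_eq_one]
  rfl

theorem forall_comp_eq_iff {g : Word ≃. Word} (hg : IsRightIdealIso g) :
    (∀ u v, v ∈ g u → v = u) ↔ ∀ u ∈ minDom g, u ∈ g u := by
  constructor
  · rintro h u ⟨⟨v, hv⟩, -⟩
    exact h u v hv ▸ hv
  · intro h u v hv
    obtain ⟨p, hp, x, rfl⟩ := exists_prefix_mem_minDom ⟨v, hv⟩
    exact Option.mem_unique hv (hg.map_append _ _ (h p hp) x)

/-! ### Depth-first search -/

/-- `v` lies in a subtree that branches off to the right of the path to `u`. -/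
def RightOf (u v : Word) : Prop := ∃ r, r ++ [false] <+: u ∧ r ++ [true] <+: v

/-- A search that is about to visit `u` still has to visit `v`. -/
def Remaining (u v : Word) : Prop := u <+: v ∨ RightOf u v

theorem not_rightOf_self (u : Word) : ¬ RightOf u u := by
  rintro ⟨r, h1, h2⟩
  have := (List.prefix_of_prefix_length_le h1 h2 (by simp)).eq_of_length (by simp)
  simp at this

theorem not_rightOf_nil (v : Word) : ¬ RightOf [] v := by
  rintro ⟨r, h1, -⟩
  simp at h1

theorem rightOf_concat_true {u v : Word} : RightOf (u ++ [true]) v ↔ RightOf u v := by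
  simp [RightOf, List.prefix_concat_iff]

/-- Turning a final `false` into `true` leaves exactly what lies to the right of the old branch. -/
theorem remaining_concat_true {u v : Word} :
    Remaining (u ++ [true]) v ↔ RightOf (u ++ [false]) v := by
  rw [Remaining, rightOf_concat_true]
  simp [RightOf, List.prefix_concat_iff, or_and_right, exists_or]

/-- Descending to the left child skips nothing but `u` itself. -/
theorem remaining_concat_false {u v : Word} (h : v ≠ u) :
    Remaining (u ++ [false]) v ↔ Remaining u v := by
  have h1 : RightOf (u ++ [false]) v ↔ u ++ [true] <+: v ∨ RightOf u v := by
    simp [RightOf, List.prefix_concat_iff, or_and_right, exists_or]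
  have h2 : u <+: v ↔ u ++ [false] <+: v ∨ u ++ [true] <+: v := by
    constructor
    · rintro ⟨_ | ⟨_ | _, t⟩, rfl⟩ <;> simp_all
    · rintro (h | h) <;> exact (List.prefix_append _ _).trans h
  rw [Remaining, Remaining, h1, h2, or_assoc]

end Thompson

/-! ### Properties that all computations reach within a time bound -/

/-- Every path of `R` that starts at `a` meets `Q` after at most `t` steps, and does not get stuck
before. -/
inductive Within {α : Type*} (R : α → α → Prop) (Q : α → Prop) : ℕ → α → Prop
  | here {t : ℕ} {a : α} : Q a → Within R Q t a
  | step {t : ℕ} {a : α} : (∃ b, R a b) → (∀ b, R a b → Within R Q t b) → Within R Q (t + 1) a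

namespace Within

variable {α : Type*} {R : α → α → Prop} {Q Q' : α → Prop} {s t : ℕ} {a b : α}

theorem mono (h : Within R Q s a) (hst : s ≤ t) : Within R Q t a := by
  induction h generalizing t with
  | here h => exact here h
  | step h1 _ ih =>
    obtain ⟨t, rfl⟩ := Nat.exists_eq_add_of_le' (le_of_add_le_right hst)
    exact step h1 fun b hb => ih b hb (by omega)

theorem bind (h : Within R Q s a) (hQ : ∀ b, Q b → Within R Q' t b) : Within R Q' (s + t) a := by
  induction h with
  | here h => exact (hQ _ h).mono (by omega)
  | step h1 _ ih =>
    rw [add_right_comm]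
    exact step h1 ih

theorem imp (h : Within R Q t a) (hQ : ∀ b, Q b → Q' b) : Within R Q' t a :=
  h.bind (t := 0) fun b hb => here (hQ b hb)

theorem of_eq (hR : ∀ c, R a c ↔ c = b) (h : Within R Q t b) : Within R Q (t + 1) a :=
  step ⟨b, (hR b).2 rfl⟩ fun c hc => (hR c).1 hc ▸ h

end Within

/-! ### From abstract step relations to machine computations -/

namespace TimeComplexity.Machine

variable {Γ : Type} {M : Machine Γ}

theorem Computes.head {t : ℕ} {c c' c'' : M.Cfg} (h : M.Step c c') (h' : M.Computes t c' c'') :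
    M.Computes (t + 1) c c'' := by
  induction h' with
  | zero => exact .succ (.zero _) h
  | succ _ h2 ih => exact .succ (ih h) h2

theorem Computes.exists_head {t : ℕ} {c c'' : M.Cfg} (h : M.Computes (t + 1) c c'') :
    ∃ c', M.Step c c' ∧ M.Computes t c' c'' := by
  induction t generalizing c'' with
  | zero =>
    obtain _ | ⟨h1, h2⟩ := h
    cases h1
    exact ⟨_, h2, .zero _⟩
  | succ t ih =>
    obtain _ | ⟨h1, h2⟩ := h
    obtain ⟨c', h3, h4⟩ := ih h1
    exact ⟨c', h3, .succ h4 h2⟩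

variable {α : Type*} {R R' : α → α → Prop} {Q : α → Prop} {conc : α → M.Cfg} {t : ℕ} {a : α}

/-- Controls all computations at once: it gives the time bound, and the correctness of every halting
computation. -/
theorem computes_of_within (hbis : ∀ a d, M.Step (conc a) d ↔ ∃ b, R a b ∧ d = conc b)
    (h : Within R Q t a) (hQ : ∀ a, Q a → ∀ b, ¬ R a b) {s : ℕ} {d : M.Cfg}
    (hd : M.Computes s (conc a) d) : s ≤ t ∧ (M.Halted d → ∃ b, Q b ∧ d = conc b) := by
  induction h generalizing s with
  | here h =>
    cases s with
    | zero =>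
      cases hd
      exact ⟨Nat.zero_le _, fun _ => ⟨_, h, rfl⟩⟩
    | succ s =>
      obtain ⟨c, h1, -⟩ := hd.exists_head
      obtain ⟨b, hb, -⟩ := (hbis _ _).1 h1
      exact absurd hb (hQ _ h b)
  | step h1 _ ih =>
    cases s with
    | zero =>
      cases hd
      obtain ⟨b, hb⟩ := h1
      exact ⟨Nat.zero_le _, fun hh => absurd ((hbis _ _).2 ⟨b, hb, rfl⟩) (hh _)⟩
    | succ s =>
      obtain ⟨c, h2, h3⟩ := hd.exists_head
      obtain ⟨b, hb, rfl⟩ := (hbis _ _).1 h2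
      obtain ⟨h4, h5⟩ := ih b hb h3
      exact ⟨by omega, h5⟩

/-- `R'` may be a restriction of the true step relation `R`, so one well-guided run can be exhibited
among the nondeterministic ones. -/
theorem exists_computes_of_within (hbis : ∀ a d, M.Step (conc a) d ↔ ∃ b, R a b ∧ d = conc b)
    (hR : ∀ a b, R' a b → R a b) (h : Within R' Q t a) :
    ∃ s b, M.Computes s (conc a) (conc b) ∧ Q b := by
  induction h with
  | here h => exact ⟨0, _, .zero _, h⟩
  | step h1 _ ih =>
    obtain ⟨b, hb⟩ := h1
    obtain ⟨s, c, h2, h3⟩ := ih b hb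
    exact ⟨s + 1, c, .head ((hbis _ _).2 ⟨b, hR _ _ hb, rfl⟩) h2, h3⟩

end TimeComplexity.Machine

/-! ### Tapes with finitely many non-blank cells -/

namespace ListTape

open Turing

variable {α β : Type} (e : α → β)

/-- The tape whose non-blank cells hold `l.reverse` to the left of the head and `r` at the head and
to its right. -/
def ofLists (l r : List α) : Tape (Option β) :=
  Tape.mk' (ListBlank.mk (l.map fun x => some (e x))) (ListBlank.mk (r.map fun x => some (e x)))

variable {e} (x y : α) (l r : List α)

/-- Trailing blanks do not count, so erasing the last letter of a tape leaves no trace. -/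
theorem mk_singleton_none : ListBlank.mk [(none : Option β)] = ListBlank.mk [] :=
  Quotient.sound (Or.inr ⟨1, rfl⟩)

@[simp] theorem head_cons : (ofLists e l (x :: r)).head = some (e x) := rfl

@[simp] theorem head_nil : (ofLists e l []).head = none := rfl

@[simp] theorem head_left_nil : ((ofLists e [] r).move .left).head = none := by
  simp only [ofLists, Tape.move_left_mk', Tape.mk'_head, ListBlank.head_cons]
  rfl

@[simp] theorem left_cons :
    (ofLists e (x :: l) r).move .left = ofLists e l (x :: r) := by
  simp [ofLists]

@[simp] theorem right_cons : (ofLists e l (x :: r)).move .right = ofLists e (x :: l) r := by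
  simp [ofLists]

@[simp] theorem write_cons : (ofLists e l (x :: r)).write (some (e y)) = ofLists e l (y :: r) := by
  simp [ofLists, Tape.write_mk']

@[simp] theorem write_nil : (ofLists e l []).write (some (e y)) = ofLists e l [y] := by
  simp only [ofLists, Tape.write_mk']
  rfl

@[simp] theorem write_left :
    ((ofLists e [] r).move .left).write (some (e x)) = ofLists e [] (x :: r) := by
  simp only [ofLists, Tape.move_left_mk', Tape.write_mk']
  rfl

@[simp] theorem write_none_nil : (ofLists e l []).write none = ofLists e l [] := by
  simpa only [head_nil] using (ofLists e l []).write_self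

@[simp] theorem write_none_left :
    ((ofLists e [] r).move .left).write none = (ofLists e [] r).move .left := by
  simpa only [head_left_nil] using ((ofLists e [] r).move .left).write_self

@[simp] theorem erase_right :
    ((ofLists e [] (x :: r)).write none).move .right = ofLists e [] r := by
  simp only [ofLists, List.map_cons, ← ListBlank.cons_mk, Tape.write_mk', Tape.move_right_mk',
    ListBlank.head_cons, ListBlank.tail_cons, List.map_nil]
  rw [ListBlank.cons_mk, mk_singleton_none]

@[simp] theorem erase : (ofLists e l [x]).write none = ofLists e l [] := by
  simp only [ofLists, List.map_cons, ← ListBlank.cons_mk, Tape.write_mk', List.map_nil,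
    ListBlank.tail_cons]
  rw [ListBlank.cons_mk, mk_singleton_none]

end ListTape

namespace Thompson

open TimeComplexity

/-! ### The machine -/

/-- Words of bounded length. -/
abbrev BWord (B : ℕ) : Type := {u : Word // u.length ≤ B}

/-- Truncation to bounded length. -/
def BWord.trunc (B : ℕ) (u : Word) : BWord B := ⟨u.take B, List.length_take_le _ _⟩

/-- Truncation only serves to keep the state set finite; on the runs considered, all lengths stay
within `B` and nothing is lost. -/
theorem BWord.trunc_val {B : ℕ} {u : Word} (hu : u.length ≤ B) : (BWord.trunc B u).1 = u :=
  List.take_of_length_le hu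

/-- The states of the machine. -/
inductive State (Γ : Type) (B : ℕ)
  /-- read the next input letter -/
  | next
  /-- the map of the letter `a` is to be applied, and `p` has been popped from the stack -/
  | pop (a : Γ) (p : BWord B)
  /-- the letters of `v` are to be pushed on the stack -/
  | push (v : BWord B)
  | rewindInput
  /-- rewind the guess, and then apply all maps `again`, or compare the guess with the stack -/
  | rewindGuess (again : Bool)
  | compare
  /-- pass to the next guess in lexicographic order -/
  | increment
  | same
  | diff
  | done

instance (Γ : Type) (B : ℕ) [Finite Γ] : Finite (State Γ B) := by
  have : Finite (BWord B) := List.finite_length_le Bool B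
  let g : (Γ × BWord B) ⊕ BWord B ⊕ Fin 9 → State Γ B := Sum.elim (fun p => .pop p.1 p.2)
    (Sum.elim .push ![.next, .rewindInput, .rewindGuess true, .rewindGuess false, .compare,
      .increment, .same, .diff, .done])
  refine Finite.of_surjective g fun q => ?_
  cases q with
  | pop a p => exact ⟨.inl (a, p), rfl⟩
  | push v => exact ⟨.inr (.inl v), rfl⟩
  | next => exact ⟨.inr (.inr 0), rfl⟩
  | rewindInput => exact ⟨.inr (.inr 1), rfl⟩
  | rewindGuess again => cases again <;> [exact ⟨.inr (.inr 3), rfl⟩; exact ⟨.inr (.inr 2), rfl⟩]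
  | compare => exact ⟨.inr (.inr 4), rfl⟩
  | increment => exact ⟨.inr (.inr 5), rfl⟩
  | same => exact ⟨.inr (.inr 6), rfl⟩
  | diff => exact ⟨.inr (.inr 7), rfl⟩
  | done => exact ⟨.inr (.inr 8), rfl⟩

section

variable {Γ : Type} {B : ℕ}

/-- The transitions. Tape `0` holds the input, tape `1` the guess, and tape `2` a stack. A letter
that is missing on the stack is read from the guess, and a letter that is missing there is
chosen from `choice`. If the stack and the guess agree in the end, then the machine stops
(`again = false`) or tries the next guess. -/
def trans (f : Γ → Word ≃. Word) (choice : Set Bool) (again : Bool) :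
    State Γ B → (Fin 3 → Option (Γ ⊕ Bool)) →
      Set (State Γ B × (Fin 3 → Option (Γ ⊕ Bool) × Option Turing.Dir))
  | .next, h => match h 0 with
    | some (.inl a) => {(.pop a (.trunc B []), ![(h 0, some .right), (h 1, none), (h 2, none)])}
    | _ => {(.rewindInput, ![(h 0, some .left), (h 1, none), (h 2, none)])}
  | .pop a p, h => match f a p.1 with
    | some v => {(.push (.trunc B v.reverse), ![(h 0, none), (h 1, none), (h 2, some .left)])}
    | none => match h 2 with
      | some (.inr b) =>
        {(.pop a (.trunc B (p.1 ++ [b])), ![(h 0, none), (h 1, none), (none, some .right)])}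
      | _ => match h 1 with
        | some (.inr b) =>
          {(.pop a (.trunc B (p.1 ++ [b])), ![(h 0, none), (h 1, some .right), (h 2, none)])}
        | _ => {r | ∃ b ∈ choice, r = (.pop a (.trunc B (p.1 ++ [b])),
            ![(h 0, none), (some (.inr b), some .right), (h 2, none)])}
  | .push v, h => match v.1 with
    | [] => {(.next, ![(h 0, none), (h 1, none), (h 2, some .right)])}
    | b :: v =>
      {(.push (.trunc B v), ![(h 0, none), (h 1, none), (some (.inr b), some .left)])}
  | .rewindInput, h => match h 0 with
    | some _ => {(.rewindInput, ![(h 0, some .left), (h 1, none), (h 2, none)])}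
    | none => {(.rewindGuess false, ![(h 0, some .right), (h 1, some .left), (h 2, none)])}
  | .rewindGuess again', h => match h 1 with
    | some _ => {(.rewindGuess again', ![(h 0, none), (h 1, some .left), (h 2, none)])}
    | none => {(bif again' then .next else .compare,
        ![(h 0, none), (h 1, some .right), (h 2, none)])}
  | .compare, h => match h 1, h 2 with
    | some (.inr x), some (.inr y) =>
      if x = y then {(.compare, ![(h 0, none), (h 1, some .right), (none, some .right)])}
      else {(.diff, ![(h 0, none), (h 1, none), (h 2, none)])}
    | none, none => {(bif again then .increment else .same,
        ![(h 0, none), (h 1, some .left), (h 2, none)])}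
    | _, _ => {(.diff, ![(h 0, none), (h 1, none), (h 2, none)])}
  | .increment, h => match h 1 with
    | some (.inr true) => {(.increment, ![(h 0, none), (none, some .left), (h 2, none)])}
    | some (.inr false) =>
      {(.rewindGuess true, ![(h 0, none), (some (.inr true), some .left), (h 2, none)])}
    | _ => {(.done, ![(h 0, none), (h 1, none), (h 2, none)])}
  | .same, _ => ∅
  | .diff, _ => ∅
  | .done, _ => ∅

/-- The machine with the transitions `trans f choice again`. -/
noncomputable def machine [Finite Γ] (f : Γ → Word ≃. Word) (B : ℕ) (choice : Set Bool)
    (again : Bool) (accept : Set (State Γ B)) : Machine Γ where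
  workTapes := 2
  State := State Γ B
  stateFintype := Fintype.ofFinite _
  Aux := Bool
  auxFintype := inferInstance
  start := .next
  accept := accept
  trans := trans f choice again

theorem trans_subsingleton (f : Γ → Word ≃. Word) (b again : Bool) (q : State Γ B)
    (h : Fin 3 → Option (Γ ⊕ Bool)) : (trans f {b} again q h).Subsingleton := by
  cases q <;> simp only [trans] <;> repeat' split
  all_goals first
    | exact Set.subsingleton_singleton
    | exact Set.subsingleton_empty
    | (rintro _ ⟨_, rfl, rfl⟩ _ ⟨_, rfl, rfl⟩; rfl)

/-! ### The machine in terms of lists -/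

/-- A configuration: the state, the input to the left of the head (reversed) and to its right,
the guess likewise, and the stack. -/
structure LCfg (Γ : Type) (B : ℕ) where
  state : State Γ B
  left : List Γ
  right : List Γ
  gleft : Word
  gright : Word
  stack : Word

/-- The steps; the choice of a letter may depend on the guess made so far. -/
def LStep (f : Γ → Word ≃. Word) (choice : Word → Set Bool) (again : Bool) (c c' : LCfg Γ B) :
    Prop :=
  match c with
  | ⟨q, l, r, gl, gr, s⟩ =>
    match q with
    | .next => match r with
      | a :: r => c' = ⟨.pop a (.trunc B []), a :: l, r, gl, gr, s⟩
      | [] => c' = ⟨.rewindInput, l, [], gl, gr, s⟩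
    | .pop a p => match f a p.1 with
      | some v => c' = ⟨.push (.trunc B v.reverse), l, r, gl, gr, s⟩
      | none => match s with
        | b :: s => c' = ⟨.pop a (.trunc B (p.1 ++ [b])), l, r, gl, gr, s⟩
        | [] => match gr with
          | b :: gr => c' = ⟨.pop a (.trunc B (p.1 ++ [b])), l, r, b :: gl, gr, []⟩
          | [] => ∃ b ∈ choice gl.reverse,
              c' = ⟨.pop a (.trunc B (p.1 ++ [b])), l, r, b :: gl, [], []⟩
    | .push v => match v.1 with
      | [] => c' = ⟨.next, l, r, gl, gr, s⟩
      | b :: v => c' = ⟨.push (.trunc B v), l, r, gl, gr, b :: s⟩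
    | .rewindInput => match l with
      | x :: l => c' = ⟨.rewindInput, l, x :: r, gl, gr, s⟩
      | [] => c' = ⟨.rewindGuess false, [], r, gl, gr, s⟩
    | .rewindGuess again' => match gl with
      | x :: gl => c' = ⟨.rewindGuess again', l, r, gl, x :: gr, s⟩
      | [] => c' = ⟨bif again' then .next else .compare, l, r, [], gr, s⟩
    | .compare => match gr with
      | x :: gr => match s with
        | y :: s => if x = y then c' = ⟨.compare, l, r, x :: gl, gr, s⟩
            else c' = ⟨.diff, l, r, gl, x :: gr, y :: s⟩
        | [] => c' = ⟨.diff, l, r, gl, x :: gr, []⟩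
      | [] => match s with
        | y :: s => c' = ⟨.diff, l, r, gl, [], y :: s⟩
        | [] => c' = ⟨bif again then .increment else .same, l, r, gl, [], []⟩
    | .increment => match gl with
      | true :: gl => c' = ⟨.increment, l, r, gl, [], s⟩
      | false :: gl => c' = ⟨.rewindGuess true, l, r, gl, [true], s⟩
      | [] => c' = ⟨.done, l, r, [], [], s⟩
    | .same => False
    | .diff => False
    | .done => False

/-- The input tape. -/
def inputTape (c : LCfg Γ B) : Turing.Tape (Option (Γ ⊕ Bool)) :=
  match c.state with
  -- While rewinding, the head is one cell to the left of the boundary between the lists.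
  | .rewindInput => (ListTape.ofLists Sum.inl c.left c.right).move .left
  | _ => ListTape.ofLists Sum.inl c.left c.right

/-- The tape with the guess. -/
def guessTape (c : LCfg Γ B) : Turing.Tape (Option (Γ ⊕ Bool)) :=
  match c.state with
  | .rewindGuess _ => (ListTape.ofLists Sum.inr c.gleft c.gright).move .left
  | .increment => (ListTape.ofLists Sum.inr c.gleft []).move .left
  | .same => (ListTape.ofLists Sum.inr c.gleft c.gright).move .left
  | .done => (ListTape.ofLists Sum.inr c.gleft []).move .left
  | _ => ListTape.ofLists Sum.inr c.gleft c.gright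

/-- The tape with the stack. -/
def stackTape (c : LCfg Γ B) : Turing.Tape (Option (Γ ⊕ Bool)) :=
  match c.state with
  -- While pushing, the head waits on the blank cell above the top of the stack.
  | .push _ => (ListTape.ofLists Sum.inr [] c.stack).move .left
  | _ => ListTape.ofLists Sum.inr [] c.stack

/-- Write a letter on a tape, then move its head. -/
def writeMove {β : Type} (T : Turing.Tape (Option β)) (p : Option β × Option Turing.Dir) :
    Turing.Tape (Option β) :=
  match p.2 with
  | none => T.write p.1
  | some d => (T.write p.1).move d

@[simp] theorem writeMove_none {β : Type} (T : Turing.Tape (Option β)) (x : Option β) :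
    writeMove T (x, none) = T.write x := rfl

@[simp] theorem writeMove_some {β : Type} (T : Turing.Tape (Option β)) (x : Option β)
    (d : Turing.Dir) : writeMove T (x, some d) = (T.write x).move d := rfl

variable {f : Γ → Word ≃. Word} {choice : Set Bool} {again : Bool}

/-- An equivalence is needed: one direction bounds all runs, the other produces an accepting run. -/
theorem exists_trans_iff (c : LCfg Γ B)
    (X : State Γ B × Turing.Tape (Option (Γ ⊕ Bool)) × Turing.Tape (Option (Γ ⊕ Bool)) ×
      Turing.Tape (Option (Γ ⊕ Bool))) :
    (∃ r ∈ trans f choice again c.state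
        ![(inputTape c).head, (guessTape c).head, (stackTape c).head],
      X = (r.1, writeMove (inputTape c) (r.2 0), writeMove (guessTape c) (r.2 1),
        writeMove (stackTape c) (r.2 2))) ↔
    ∃ c', LStep f (fun _ => choice) again c c' ∧
      X = (c'.state, inputTape c', guessTape c', stackTape c') := by
  obtain ⟨q, l, r, gl, gr, s⟩ := c
  cases q with
  | next =>
    cases r <;> simp [trans, LStep, inputTape, guessTape, stackTape]
  | pop a p =>
    rcases h : f a p.1 with _ | v
    · rcases s with _ | ⟨b, s⟩
      · rcases gr with _ | ⟨b, gr⟩ <;>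
          simp [trans, LStep, inputTape, guessTape, stackTape, h, or_and_right, exists_or,
            and_assoc]
      · simp [trans, LStep, inputTape, guessTape, stackTape, h]
    · simp [trans, LStep, inputTape, guessTape, stackTape, h]
  | push v =>
    obtain ⟨_ | ⟨b, v⟩, hv⟩ := v <;>
      simp [trans, LStep, inputTape, guessTape, stackTape]
  | rewindInput => cases l <;> simp [trans, LStep, inputTape, guessTape, stackTape]
  | rewindGuess again' =>
    cases gl <;> cases again' <;>
      simp [trans, LStep, inputTape, guessTape, stackTape]
  | compare =>
    rcases gr with _ | ⟨x, gr⟩ <;> rcases s with _ | ⟨y, s⟩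
    · cases again <;> simp [trans, LStep, inputTape, guessTape, stackTape]
    · simp [trans, LStep, inputTape, guessTape, stackTape]
    · simp [trans, LStep, inputTape, guessTape, stackTape]
    · by_cases h : x = y <;>
        simp [trans, LStep, inputTape, guessTape, stackTape, h]
  | increment =>
    rcases gl with _ | ⟨_ | _, gl⟩ <;>
      simp [trans, LStep, inputTape, guessTape, stackTape]
  | same => simp [trans, LStep]
  | diff => simp [trans, LStep]
  | done => simp [trans, LStep]

variable [Finite Γ] {accept : Set (State Γ B)}

/-- The configuration of the machine with a given state and given tapes. -/
noncomputable def cfgOf (f : Γ → Word ≃. Word) (choice : Set Bool) (again : Bool)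
    (accept : Set (State Γ B)) (X : State Γ B × Turing.Tape (Option (Γ ⊕ Bool)) ×
      Turing.Tape (Option (Γ ⊕ Bool)) × Turing.Tape (Option (Γ ⊕ Bool))) :
    (machine f B choice again accept).Cfg where
  state := X.1
  tape := ![X.2.1, X.2.2.1, X.2.2.2]

/-- The configuration of the machine that is described by lists. -/
noncomputable def LCfg.toCfg (f : Γ → Word ≃. Word) (choice : Set Bool) (again : Bool)
    (accept : Set (State Γ B)) (c : LCfg Γ B) : (machine f B choice again accept).Cfg :=
  cfgOf f choice again accept (c.state, inputTape c, guessTape c, stackTape c)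

theorem init_eq (w : List Γ) : (machine f B choice again accept).init w =
    LCfg.toCfg f choice again accept ⟨.next, [], w, [], [], []⟩ := by
  refine congrArg (Machine.Cfg.mk _) (funext fun i => ?_)
  change Fin 3 at i
  fin_cases i <;> rfl

theorem step_toCfg_iff (c : LCfg Γ B) (d : (machine f B choice again accept).Cfg) :
    (machine f B choice again accept).Step (c.toCfg f choice again accept) d ↔
      ∃ c', LStep f (fun _ => choice) again c c' ∧ d = c'.toCfg f choice again accept := by
  have key : (machine f B choice again accept).Step (c.toCfg f choice again accept) d ↔
      ∃ r ∈ trans f choice again c.state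
        ![(inputTape c).head, (guessTape c).head, (stackTape c).head],
      d = cfgOf f choice again accept (r.1, writeMove (inputTape c) (r.2 0),
        writeMove (guessTape c) (r.2 1), writeMove (stackTape c) (r.2 2)) := by
    have h1 : (fun i => ((c.toCfg f choice again accept).tape i).head) =
        ![(inputTape c).head, (guessTape c).head, (stackTape c).head] := by
      funext i
      change Fin 3 at i
      fin_cases i <;> rfl
    have h2 (r : State Γ B × (Fin 3 → Option (Γ ⊕ Bool) × Option Turing.Dir)) :
        (fun i => (machine f B choice again accept).writeMove
          ((c.toCfg f choice again accept).tape i) (r.2 i)) =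
        ![writeMove (inputTape c) (r.2 0),
        writeMove (guessTape c) (r.2 1),
        writeMove (stackTape c) (r.2 2)] := by
      funext i
      change Fin 3 at i
      fin_cases i <;> rfl
    constructor
    · rintro ⟨r, hr, rfl⟩
      rw [h1] at hr
      exact ⟨r, hr, congrArg _ (h2 r)⟩
    · rintro ⟨r, hr, rfl⟩
      refine ⟨r, ?_, congrArg _ (h2 r).symm⟩
      rw [h1]
      exact hr
  rw [key]
  constructor
  · rintro ⟨r, hr, rfl⟩
    obtain ⟨c', h, e⟩ := (exists_trans_iff c _).1 ⟨r, hr, rfl⟩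
    exact ⟨c', h, congrArg (cfgOf f choice again accept) e⟩
  · rintro ⟨c', h, rfl⟩
    obtain ⟨r, hr, e⟩ := (exists_trans_iff c _).2 ⟨c', h, rfl⟩
    exact ⟨r, hr, congrArg (cfgOf f choice again accept) e⟩

end

end Thompson

/-! ### Duration and effect of the phases of a pass -/

namespace Thompson

section

variable {Γ : Type} {f : Γ → Word ≃. Word} {K B : ℕ} {choice : Word → Set Bool} {again : Bool}
  {I : Word → Prop} {w l r : List Γ} {gl gr s : Word}

/-- The invariant is that `p` followed by the stack is the image under `g` of the part of the guess
read so far; reading a letter extends both sides by it. A new letter is chosen only when the stack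
and the guess are exhausted and `f a` is undefined at `p`. Popping ends once `p` has length `K`,
whence the bound. -/
theorem within_pop (hT : IsTable f K B) (hne : ∀ u, (choice u).Nonempty) {a : Γ}
    {g : Word ≃. Word} (hg : IsRightIdealIso g)
    (hI : ∀ u, I u → u ∉ dom (g.trans (f a)) → ∀ b ∈ choice u, I (u ++ [b]))
    (p : BWord B) (hp : p.1.length ≤ K) (hs : p.1 ++ s ∈ g gl.reverse)
    (hi : I (gl.reverse ++ gr)) :
    Within (LStep f choice again) (fun c => ∃ gl' gr' s' v,
        c = ⟨.push (.trunc B v.reverse), l, r, gl', gr', s'⟩ ∧ v.length ≤ B ∧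
        v ++ s' ∈ (g.trans (f a)) gl'.reverse ∧ I (gl'.reverse ++ gr'))
      (K - p.1.length + 1) ⟨.pop a p, l, r, gl, gr, s⟩ := by
  obtain ⟨n, hn⟩ : ∃ n, n = K - p.1.length := ⟨_, rfl⟩
  rw [← hn]
  induction n generalizing p gl gr s with
  | zero =>
    obtain ⟨v, hv⟩ := hT.mem_dom a p.1 (by omega)
    refine .of_eq (b := ⟨.push (.trunc B v.reverse), l, r, gl, gr, s⟩) (fun c => ?_) (.here ?_)
    · simp [LStep, Option.mem_def.1 hv]
    · exact ⟨gl, gr, s, v, rfl, hT.length_le a _ _ hp hv, (PEquiv.mem_trans _ _ _ _).2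
        ⟨_, hs, (hT.iso a).map_append _ _ hv s⟩, hi⟩
  | succ n ih =>
    rcases hv : f a p.1 with _ | v
    · have hpK : p.1.length < K := by omega
      have hlen (b : Bool) : (p.1 ++ [b]).length ≤ K := by simpa using hpK
      have htr (b : Bool) : (BWord.trunc B (p.1 ++ [b])).1 = p.1 ++ [b] :=
        BWord.trunc_val ((hlen b).trans hT.le)
      have hn' (b : Bool) : n = K - (BWord.trunc B (p.1 ++ [b])).1.length := by
        rw [htr, List.length_append, List.length_singleton]
        omega
      rcases s with _ | ⟨b, s⟩
      · rcases gr with _ | ⟨b, gr⟩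
        · have hd : gl.reverse ∉ dom (g.trans (f a)) := by
            -- With an empty stack, `p` is the whole image of the guess, and `f a` is undefined
            -- there.
            rintro ⟨z, hz⟩
            obtain ⟨y, hy, hz⟩ := (PEquiv.mem_trans _ _ _ _).1 hz
            obtain rfl := Option.mem_unique hy hs
            rw [List.append_nil, Option.mem_def, hv] at hz
            cases hz
          refine .step ?_ ?_
          · obtain ⟨b, hb⟩ := hne gl.reverse
            refine ⟨⟨.pop a (.trunc B (p.1 ++ [b])), l, r, b :: gl, [], []⟩, ?_⟩
            simp only [LStep, hv]
            exact ⟨b, hb, rfl⟩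
          · intro c hc
            simp only [LStep, hv] at hc
            obtain ⟨b, hb, rfl⟩ := hc
            refine ih _ ((htr b).symm ▸ hlen b) ?_ ?_ (hn' b)
            · rw [htr]
              simpa using hg.map_append _ _ hs [b]
            · simpa using hI _ (by simpa using hi) hd b hb
        · refine .of_eq (b := ⟨.pop a (.trunc B (p.1 ++ [b])), l, r, b :: gl, gr, []⟩)
            (fun c => by simp [LStep, hv]) (ih _ ((htr b).symm ▸ hlen b) ?_ ?_ (hn' b))
          · rw [htr]
            simpa using hg.map_append _ _ hs [b]
          · simpa using hi
      · refine .of_eq (b := ⟨.pop a (.trunc B (p.1 ++ [b])), l, r, gl, gr, s⟩)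
          (fun c => by simp [LStep, hv]) (ih _ ((htr b).symm ▸ hlen b) ?_ hi (hn' b))
        rw [htr]
        simpa using hs
    · refine .of_eq (b := ⟨.push (.trunc B v.reverse), l, r, gl, gr, s⟩)
        (fun c => by simp [LStep, hv]) (.here ?_)
      exact ⟨gl, gr, s, v, rfl, hT.length_le a _ _ hp hv, (PEquiv.mem_trans _ _ _ _).2
        ⟨_, hs, (hT.iso a).map_append _ _ hv s⟩, hi⟩

theorem within_push (v : Word) (hv : v.length ≤ B) :
    Within (LStep f choice again) (fun c => c = ⟨.next, l, r, gl, gr, v.reverse ++ s⟩)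
      (v.length + 1) ⟨.push (.trunc B v), l, r, gl, gr, s⟩ := by
  induction v generalizing s with
  | nil =>
    exact .of_eq (b := ⟨.next, l, r, gl, gr, s⟩)
      (fun c => by simp only [LStep, BWord.trunc_val hv]) (.here (by simp))
  | cons b v ih =>
    refine .of_eq (b := ⟨.push (.trunc B v), l, r, gl, gr, b :: s⟩)
      (fun c => by simp only [LStep, BWord.trunc_val hv]) ?_
    simpa using ih (s := b :: s) (Nat.le_of_succ_le hv)

/-- Each input letter costs one step for reading it, at most `K + 1 ≤ B + 1` for popping, and at
most `B + 1` for pushing. -/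
theorem within_apply (hT : IsTable f K B) (hne : ∀ u, (choice u).Nonempty)
    (hI : ∀ u, I u → u ∉ dom (comp f w) → ∀ b ∈ choice u, I (u ++ [b]))
    (hw : w = l.reverse ++ r) (hs : s ∈ comp f l.reverse gl.reverse) (hi : I (gl.reverse ++ gr)) :
    Within (LStep f choice again) (fun c => ∃ gl' gr' s',
        c = (⟨.next, w.reverse, [], gl', gr', s'⟩ : LCfg Γ B) ∧
        s' ∈ comp f w gl'.reverse ∧ I (gl'.reverse ++ gr'))
      (r.length * (2 * B + 3)) ⟨.next, l, r, gl, gr, s⟩ := by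
  induction r generalizing l gl gr s with
  | nil =>
    subst hw
    exact .here ⟨gl, gr, s, by simp, by simpa using hs, hi⟩
  | cons a r ih =>
    have hB := hT.le
    have hcomp : comp f w = ((comp f l.reverse).trans (f a)).trans (comp f r) := by
      rw [hw, comp_append, comp, PEquiv.trans_assoc]
    have hpop := within_pop (s := s) (gr := gr) (l := a :: l) (r := r) (again := again) hT hne
      (a := a) (hT.comp_iso l.reverse)
      -- Composing with the maps of the remaining letters can only shrink the domain.
      (fun u hu hd => hI u hu fun ⟨z, hz⟩ => hd (by
        rw [hcomp] at hz
        obtain ⟨y, hy, -⟩ := (PEquiv.mem_trans _ _ _ _).1 hz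
        exact ⟨y, hy⟩)) (.trunc B []) (by simp [BWord.trunc]) (by simpa [BWord.trunc] using hs) hi
    have h1 : Within (LStep f choice again) (fun c => ∃ gl' gr' s',
        c = (⟨.next, a :: l, r, gl', gr', s'⟩ : LCfg Γ B) ∧
        s' ∈ comp f (a :: l).reverse gl'.reverse ∧ I (gl'.reverse ++ gr'))
        (2 * B + 2) ⟨.pop a (.trunc B []), a :: l, r, gl, gr, s⟩ := by
      refine (hpop.bind (t := B + 1) ?_).mono (by omega)
      rintro _ ⟨gl', gr', s', v, rfl, hvB, hv, hi'⟩
      refine ((within_push v.reverse (by simpa using hvB)).mono (by simpa using hvB)).imp ?_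
      rintro _ rfl
      refine ⟨gl', gr', _, rfl, ?_, hi'⟩
      rw [List.reverse_reverse, List.reverse_cons, comp_append, comp, comp, PEquiv.trans_refl]
      exact hv
    refine (Within.of_eq (fun c => Iff.rfl) (h1.bind (t := r.length * (2 * B + 3)) ?_)).mono ?_
    · rintro _ ⟨gl', gr', s', rfl, hs', hi'⟩
      exact ih (by simpa using hw) hs' hi'
    · rw [List.length_cons]
      linarith

theorem within_rewindInput :
    Within (LStep f choice again)
      (fun c => c = (⟨.rewindGuess false, [], l.reverse ++ r, gl, gr, s⟩ : LCfg Γ B))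
      (l.length + 1) ⟨.rewindInput, l, r, gl, gr, s⟩ := by
  induction l generalizing r with
  | nil => exact .of_eq (fun c => Iff.rfl) (.here rfl)
  | cons a l ih =>
    refine .of_eq (fun c => Iff.rfl) ?_
    simpa using ih (r := a :: r)

theorem within_rewindGuess (again' : Bool) :
    Within (LStep f choice again)
      (fun c => c = (⟨bif again' then .next else .compare, l, r, [], gl.reverse ++ gr, s⟩ :
        LCfg Γ B))
      (gl.length + 1) ⟨.rewindGuess again', l, r, gl, gr, s⟩ := by
  induction gl generalizing gr with
  | nil => exact .of_eq (fun c => Iff.rfl) (.here rfl)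
  | cons a gl ih =>
    refine .of_eq (fun c => Iff.rfl) ?_
    simpa using ih (gr := a :: gr)

theorem within_compare :
    Within (LStep f choice again)
      (fun c : LCfg Γ B => (s = gr ∧
        c = ⟨bif again then .increment else .same, l, r, gr.reverse ++ gl, [], []⟩) ∨
        (s ≠ gr ∧ c.state = .diff))
      (gr.length + 1) ⟨.compare, l, r, gl, gr, s⟩ := by
  induction gr generalizing gl s with
  | nil =>
    cases s with
    | nil => exact .of_eq (fun c => Iff.rfl) (.here (.inl ⟨rfl, rfl⟩))
    | cons y s => exact .of_eq (fun c => Iff.rfl) (.here (.inr ⟨by simp, rfl⟩))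
  | cons x gr ih =>
    cases s with
    | nil => exact .of_eq (fun c => Iff.rfl) (.here (.inr ⟨by simp, rfl⟩))
    | cons y s =>
      by_cases hxy : x = y
      · refine .of_eq (b := ⟨.compare, l, r, x :: gl, gr, s⟩) (fun c => by simp [LStep, hxy]) ?_
        simpa [hxy] using ih (gl := x :: gl) (s := s)
      · exact .of_eq (b := ⟨.diff, l, r, gl, x :: gr, y :: s⟩) (fun c => by simp [LStep, hxy])
          (.here (.inr ⟨by simp [Ne.symm hxy], rfl⟩))

/-- In one pass, the machine extends the guess `p` to a word `u` of the prefix code, and finds out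
whether `u` is fixed. -/
theorem within_pass (hT : IsTable f K B) (hne : ∀ u, (choice u).Nonempty)
    (hI : ∀ u, I u → u ∉ dom (comp f w) → ∀ b ∈ choice u, I (u ++ [b]))
    (hmin : ∀ u, I u → NoProperPrefix (comp f w) u) {p : Word} (hp : I p) :
    Within (LStep f choice again)
      (fun c : LCfg Γ B => ∃ u ∈ minDom (comp f w), I u ∧ ((u ∈ comp f w u ∧
        c = ⟨bif again then .increment else .same, [], w, u.reverse, [], []⟩) ∨
        (u ∉ comp f w u ∧ c.state = .diff)))
      ((2 * B + 2 * K + 4) * w.length + 4) ⟨.next, [], w, [], p, []⟩ := by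
  have h1 := within_apply (again := again) (l := []) (r := w) (s := []) (gl := []) (gr := p)
    hT hne hI rfl (by simp [comp]) hp
  refine (h1.bind (t := (2 * K + 1) * w.length + 4) ?_).mono (by linarith)
  rintro _ ⟨gl, gr, s, rfl, hs, hi⟩
  -- The part of the guess read so far is already in the domain, so by minimality no part is left
  -- unread.
  have hgr : gr = [] := by
    have := hmin _ hi _ (List.prefix_append _ _) ⟨s, hs⟩
    simpa using this
  subst hgr
  rw [List.append_nil] at hi
  have hlen := hT.length_le_of_noProperPrefix_comp (hmin _ hi)
  rw [List.length_reverse] at hlen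
  have h2 : Within (LStep f choice again) (fun c => c = (⟨.compare, [], w, [], gl.reverse, s⟩ :
      LCfg Γ B)) (1 + (w.length + 1) + (gl.length + 1)) ⟨.next, w.reverse, [], gl, [], s⟩ := by
    rw [add_assoc, add_comm]
    refine .of_eq (fun c => Iff.rfl) (.bind (s := w.length + 1)
      (Q := fun c => c = ⟨.rewindGuess false, [], w, gl, [], s⟩) ?_ fun c hc => ?_)
    · simpa using within_rewindInput (f := f) (choice := choice) (again := again)
        (l := w.reverse) (r := []) (gl := gl) (gr := []) (s := s) (B := B)
    · subst hc
      simpa using within_rewindGuess (f := f) (choice := choice) (again := again)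
        (l := []) (r := w) (gl := gl) (gr := []) (s := s) (B := B) false
  refine (h2.bind (t := gl.length + 1) ?_).mono (by linarith)
  rintro _ rfl
  have h3 := within_compare (f := f) (choice := choice) (again := again) (l := []) (r := w)
    (gl := []) (gr := gl.reverse) (s := s) (B := B)
  rw [List.length_reverse] at h3
  refine h3.imp ?_
  rintro c (⟨rfl, rfl⟩ | ⟨hne, hc⟩)
  · exact ⟨_, ⟨⟨_, hs⟩, hmin _ hi⟩, hi, .inl ⟨hs, by simp⟩⟩
  · exact ⟨_, ⟨⟨_, hs⟩, hmin _ hi⟩, hi, .inr ⟨fun h => hne (Option.mem_unique hs h), hc⟩⟩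

/-- Erasing trailing `true`s does not change what lies to the right. The last `false`, if any, is
where the next branch starts; without one, nothing remains. -/
theorem within_increment :
    Within (LStep f choice again)
      (fun c : LCfg Γ B => (∃ q, q ++ [false] <+: gl.reverse ∧
        (∀ v, Remaining (q ++ [true]) v ↔ RightOf gl.reverse v) ∧
        c = ⟨.next, l, r, [], q ++ [true], s⟩) ∨
        ((∀ v, ¬ RightOf gl.reverse v) ∧ c.state = .done))
      (gl.length + 2) ⟨.increment, l, r, gl, [], s⟩ := by
  induction gl with
  | nil => exact (Within.of_eq (fun c => Iff.rfl)
      (.here (t := 0) (.inr ⟨not_rightOf_nil, rfl⟩))).mono (by simp)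
  | cons b gl ih =>
    cases b with
    | true =>
      refine (Within.of_eq (fun c => Iff.rfl) (ih.imp ?_))
      simp only [List.reverse_cons, rightOf_concat_true]
      rintro c (⟨q, h1, h2, h3⟩ | h)
      · exact .inl ⟨q, h1.trans (List.prefix_append _ _), h2, h3⟩
      · exact .inr h
    | false =>
      refine Within.of_eq (fun c => Iff.rfl) (((within_rewindGuess true).mono (by simp)).imp ?_)
      rintro _ rfl
      exact .inl ⟨gl.reverse, by simp, by simp [remaining_concat_true], rfl⟩

end

end Thompson

/-! ### Depth-first search, and the two recognising machines -/

namespace Thompson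

open TimeComplexity

section

variable {Γ : Type} {f : Γ → Word ≃. Word} {K B : ℕ} {choice : Word → Set Bool} {again : Bool}
  {w : List Γ}

theorem not_lStep {c : LCfg Γ B} (h : c.state = .same ∨ c.state = .diff ∨ c.state = .done)
    (c' : LCfg Γ B) : ¬ LStep f choice again c c' := by
  obtain ⟨q, l, r, gl, gr, s⟩ := c
  rcases h with h | h | h <;> cases h <;> exact id

/-- The depth-first search through all guesses that start at `p` or lie to the right of it. -/
theorem within_search (hT : IsTable f K B) (hfin : (minDom (comp f w)).Finite) (N : ℕ) (p : Word)
    (hp : NoProperPrefix (comp f w) p)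
    (hprev : ∀ v ∈ minDom (comp f w), ¬ Remaining p v → v ∈ comp f w v)
    (hN : {v ∈ minDom (comp f w) | Remaining p v}.ncard ≤ N) :
    Within (LStep f (fun _ => {false}) true)
      (fun c : LCfg Γ B => (c.state = .done ∧ ∀ v ∈ minDom (comp f w), v ∈ comp f w v) ∨
        (c.state = .diff ∧ ∃ v ∈ minDom (comp f w), v ∉ comp f w v))
      ((N + 1) * ((2 * B + 3 * K + 4) * w.length + 6)) ⟨.next, [], w, [], p, []⟩ := by
  induction N using Nat.strong_induction_on generalizing p with
  | h N ih =>
    have h1 := within_pass (again := true) (choice := fun _ => {false}) (w := w) (p := p)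
      -- Extending the guess by `false` while it is outside the domain skips no code word.
      (I := fun u => NoProperPrefix (comp f w) u ∧
        ∀ v ∈ minDom (comp f w), Remaining u v ↔ Remaining p v) hT
      (fun _ => Set.singleton_nonempty _)
      (by
        rintro u ⟨hu, hu'⟩ hd _ rfl
        refine ⟨hu.concat hd _, fun v hv => ?_⟩
        rw [remaining_concat_false (by rintro rfl; exact hd hv.1), hu' v hv])
      (fun u hu => hu.1) ⟨hp, fun _ _ => Iff.rfl⟩
    refine (h1.bind (t := K * w.length + 2 + N * ((2 * B + 3 * K + 4) * w.length + 6)) ?_).mono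
      (le_of_eq (by ring))
    have hS : {v ∈ minDom (comp f w) | Remaining p v}.Finite := hfin.subset fun _ h => h.1
    rintro c ⟨u, hu, ⟨-, hrem⟩, ⟨huu, rfl⟩ | ⟨huu, hc⟩⟩
    · have hmem : u ∈ {v ∈ minDom (comp f w) | Remaining p v} :=
        ⟨hu, (hrem u hu).1 (.inl (List.prefix_refl _))⟩
      -- No other code word has `u` as a prefix, so those still to be visited lie to the right of
      -- `u`.
      have hright (v : Word) (hv : v ∈ minDom (comp f w)) (hvu : v ≠ u) :
          RightOf u v ↔ Remaining p v := by
        rw [← hrem v hv, Remaining, or_iff_right fun h => hvu (hv.2 u h hu.1).symm]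
      have hinc := within_increment (f := f) (choice := fun _ => {false}) (again := true)
        (l := []) (r := w) (gl := u.reverse) (s := []) (B := B)
      rw [List.reverse_reverse, List.length_reverse] at hinc
      refine (hinc.mono (t := K * w.length + 2) ?_).bind ?_
      · simpa using hT.length_le_of_noProperPrefix_comp hu.2
      rintro c (⟨q, hq, hq', rfl⟩ | ⟨hu', hc⟩)
      -- The word `u` just tested is no longer counted, so the count drops strictly.
      · have hlt : {v ∈ minDom (comp f w) | Remaining (q ++ [true]) v}.ncard < N := by
          refine lt_of_lt_of_le (Set.ncard_lt_ncard ⟨fun v hv => ?_, fun h => ?_⟩ hS) hN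
          · have h2 := (hq' v).1 hv.2
            exact ⟨hv.1, (hright v hv.1 (by rintro rfl; exact not_rightOf_self _ h2)).1 h2⟩
          · exact not_rightOf_self u ((hq' u).1 (h hmem).2)
        obtain ⟨m, rfl⟩ := Nat.exists_eq_add_of_lt (Nat.zero_lt_of_lt hlt)
        rw [zero_add] at hlt ⊢
        refine ih m (by omega) (q ++ [true]) (hu.2.of_prefix hq) (fun v hv hvq => ?_)
          (Nat.le_of_lt_succ hlt)
        by_cases hvu : v = u
        · exact hvu ▸ huu
        · exact hprev v hv (by rwa [hq', hright v hv hvu] at hvq)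
      · refine .here (.inl ⟨hc, fun v hv => ?_⟩)
        by_cases hvu : v = u
        · exact hvu ▸ huu
        · exact hprev v hv ((hright v hv hvu).not.1 (hu' v))
    · exact .here (.inr ⟨hc, u, hu, huu⟩)

/-- The words that act as the identity. -/
def identityWords (f : Γ → Word ≃. Word) : Set (List Γ) :=
  {w | ∀ u v, v ∈ comp f w u → v = u}

theorem halted_toCfg [Finite Γ] {choice : Set Bool} {accept : Set (State Γ B)} {c : LCfg Γ B}
    (h : c.state = .same ∨ c.state = .diff ∨ c.state = .done) :
    (machine f B choice again accept).Halted (c.toCfg f choice again accept) := by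
  intro d hd
  obtain ⟨c', hc', -⟩ := (step_toCfg_iff c d).1 hd
  exact not_lStep h c' hc'

theorem exists_deterministic_machine [Finite Γ] (hf : ∀ a, IsFGEssentialIso (f a)) :
    ∃ (M : Machine Γ) (C : ℕ), M.Deterministic ∧ M.RunsInTime (fun n => C * n ^ 2 + C) ∧
      ∀ w, w ∈ identityWords f ↔ M.Accepts w := by
  obtain ⟨K, B, hT⟩ := exists_isTable hf
  obtain ⟨D, hD⟩ := hT.exists_encard_minDom_comp_le
  have hfin (w : List Γ) : (minDom (comp f w)).Finite :=
    Set.finite_of_encard_le_coe (hD w)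
  have key (w : List Γ) := within_search hT (hfin w) (D * w.length + 1) []
    (noProperPrefix_nil _) (fun v _ h => absurd (.inl List.nil_prefix) h) (by
      have h1 : (minDom (comp f w)).ncard ≤ D * w.length + 1 := by
        have := hD w
        rw [← (hfin w).cast_ncard_eq] at this
        exact_mod_cast this
      exact (Set.ncard_le_ncard (fun _ h => h.1) (hfin w)).trans h1)
  have hend (w : List Γ) (c : LCfg Γ B)
      (hc : (c.state = .done ∧ ∀ v ∈ minDom (comp f w), v ∈ comp f w v) ∨
        (c.state = .diff ∧ ∃ v ∈ minDom (comp f w), v ∉ comp f w v)) :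
      c.state = .same ∨ c.state = .diff ∨ c.state = .done := by
    rcases hc with ⟨h, -⟩ | ⟨h, -⟩ <;> simp [h]
  -- The constant generously bounds `(D * n + 2) * ((2 * B + 3 * K + 4) * n + 6)`, the number of
  -- passes times the cost of one.
  refine ⟨machine f B {false} true {.done},
    (D + 2) * (2 * (2 * B + 3 * K + 4) + 6) + (D + 2) * 6, fun q h => trans_subsingleton f _ _ q h,
    fun w t c hc => ?_, fun w => ?_⟩
  · rw [init_eq] at hc
    refine (Machine.computes_of_within step_toCfg_iff (key w)
      (fun a ha b => not_lStep (hend w a ha) b) hc).1.trans ?_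
    generalize 2 * B + 3 * K + 4 = A
    generalize w.length = n
    have h1 : n ≤ n ^ 2 := Nat.le_self_pow two_ne_zero n
    have h2 : D * n ≤ D * n ^ 2 := Nat.mul_le_mul_left _ h1
    have h3 : A * n ≤ A * n ^ 2 := Nat.mul_le_mul_left _ h1
    nlinarith [Nat.zero_le (D * A * n ^ 2), Nat.zero_le (D * n ^ 2), Nat.zero_le (D * A),
      Nat.zero_le (A * n ^ 2)]
  · rw [identityWords, Set.mem_ofPred_eq, forall_comp_eq_iff (hT.comp_iso w)]
    constructor
    · intro h
      obtain ⟨t, c, h1, h2⟩ := Machine.exists_computes_of_within (conc := LCfg.toCfg f {false} true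
        {.done}) step_toCfg_iff (fun _ _ => id) (key w)
      rw [← init_eq] at h1
      refine ⟨t, _, h1, halted_toCfg (hend w c h2), ?_⟩
      rcases h2 with ⟨h2, -⟩ | ⟨-, v, hv, hv'⟩
      · exact h2
      · exact absurd (h v hv) hv'
    · rintro ⟨t, c, h1, h2, h3⟩
      rw [init_eq] at h1
      obtain ⟨b, hb, rfl⟩ := (Machine.computes_of_within step_toCfg_iff (key w)
        (fun a ha b => not_lStep (hend w a ha) b) h1).2 h2
      rcases hb with ⟨-, hb⟩ | ⟨hb, -⟩
      · exact hb
      · have h4 : b.state = .done := h3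
        rw [hb] at h4
        cases h4

/-- If the letters of the guess are chosen according to a word `u` of the prefix code that is not
fixed, then the machine finds a difference. -/
theorem within_pass_of_mem_minDom (hT : IsTable f K B) {u : Word}
    (hu : u ∈ minDom (comp f w)) (huu : u ∉ comp f w u) :
    Within (LStep f (fun x => {b | x ++ [b] <+: u ∨ x = u ∨ ¬ x <+: u}) false)
      (fun c : LCfg Γ B => c.state = .diff)
      ((2 * B + 2 * K + 4) * w.length + 4) ⟨.next, [], w, [], [], []⟩ := by
  refine (within_pass (again := false) (w := w) (p := [])
    (I := fun x => NoProperPrefix (comp f w) x ∧ x <+: u) hT ?_ ?_ (fun _ h => h.1)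
    ⟨noProperPrefix_nil _, List.nil_prefix⟩).imp ?_
  -- The last two alternatives in the choice set only keep it non-empty when `x` is not a proper
  -- prefix of `u`.
  · intro x
    by_cases hx : x <+: u
    · obtain ⟨_ | ⟨b, t⟩, rfl⟩ := hx
      · exact ⟨true, .inr (.inl (by simp))⟩
      · exact ⟨b, .inl ⟨t, by simp⟩⟩
    · exact ⟨true, .inr (.inr hx)⟩
  · rintro x ⟨hx, hxu⟩ hd b (hb | rfl | hb)
    · exact ⟨hx.concat hd b, hb⟩
    · exact absurd hu.1 hd
    · exact absurd hxu hb
  · rintro c ⟨x, hx, ⟨-, hxu⟩, ⟨hxx, -⟩ | ⟨-, hc⟩⟩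
    · rw [hu.2 x hxu hx.1] at hxx
      exact absurd hxx huu
    · exact hc

theorem LStep.mono {choice' : Word → Set Bool} (h : ∀ u, choice u ⊆ choice' u) {c c' : LCfg Γ B}
    (hc : LStep f choice again c c') : LStep f choice' again c c' := by
  obtain ⟨q, l, r, gl, gr, s⟩ := c
  cases q with
  | pop a p =>
    rcases hv : f a p.1 with _ | v
    · rcases s with _ | ⟨b, s⟩
      · rcases gr with _ | ⟨b, gr⟩
        · simp only [LStep, hv] at hc ⊢
          obtain ⟨b, hb, hc⟩ := hc
          exact ⟨b, h _ hb, hc⟩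
        · simpa only [LStep, hv] using hc
      · simpa only [LStep, hv] using hc
    · simpa only [LStep, hv] using hc
  | _ => exact hc

/-- With unrestricted choices every run ends in linear time, and reports a difference only if some
code word is moved. Conversely, a run guided by a moved code word does find a difference. -/
theorem compl_identityWords_mem_nTime [Finite Γ] (hf : ∀ a, IsFGEssentialIso (f a)) :
    (identityWords f)ᶜ ∈ NTime (fun n => n) := by
  obtain ⟨K, B, hT⟩ := exists_isTable hf
  have key (w : List Γ) : Within (LStep f (fun _ => Set.univ) false)
      (fun c : LCfg Γ B => c.state = .same ∨
        (c.state = .diff ∧ ∃ v ∈ minDom (comp f w), v ∉ comp f w v))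
      ((2 * B + 2 * K + 4) * w.length + 4) ⟨.next, [], w, [], [], []⟩ := by
    refine (within_pass (again := false) (w := w) (p := []) hT (fun _ => Set.univ_nonempty)
      (fun u hu hd b _ => hu.concat hd b) (fun _ h => h) (noProperPrefix_nil _)).imp ?_
    rintro c ⟨u, hu, -, ⟨-, rfl⟩ | ⟨huu, hc⟩⟩
    · exact .inl rfl
    · exact .inr ⟨hc, u, hu, huu⟩
  have hend (w : List Γ) (c : LCfg Γ B) (hc : c.state = .same ∨
        (c.state = .diff ∧ ∃ v ∈ minDom (comp f w), v ∉ comp f w v)) :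
      c.state = .same ∨ c.state = .diff ∨ c.state = .done := by
    rcases hc with h | ⟨h, -⟩ <;> simp [h]
  refine ⟨machine f B Set.univ false {.diff}, 2 * B + 2 * K + 4, fun w t c hc => ?_, fun w => ?_⟩
  · rw [init_eq] at hc
    refine (Machine.computes_of_within step_toCfg_iff (key w)
      (fun a ha b => not_lStep (hend w a ha) b) hc).1.trans (by simp)
  · rw [identityWords, Set.mem_compl_iff, Set.mem_ofPred_eq, forall_comp_eq_iff (hT.comp_iso w)]
    constructor
    · intro h
      push Not at h
      obtain ⟨u, hu, huu⟩ := h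
      obtain ⟨t, c, h1, h2⟩ := Machine.exists_computes_of_within
        (conc := LCfg.toCfg f Set.univ false {.diff}) step_toCfg_iff
        (fun _ _ => LStep.mono fun _ => Set.subset_univ _) (within_pass_of_mem_minDom hT hu huu)
      rw [← init_eq] at h1
      exact ⟨t, _, h1, halted_toCfg (.inr (.inl h2)), h2⟩
    · rintro ⟨t, c, h1, h2, h3⟩ h
      rw [init_eq] at h1
      obtain ⟨b, hb, rfl⟩ := (Machine.computes_of_within step_toCfg_iff (key w)
        (fun a ha b => not_lStep (hend w a ha) b) h1).2 h2
      rcases hb with hb | ⟨-, v, hv, hv'⟩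
      · have h4 : b.state = .diff := h3
        rw [hb] at h4
        cases h4
      · exact hv' (h v hv)

end

end Thompson

theorem mainTheorem6 (Δ : Finset Thompson.V) :
    wordProblem Δ ∈ TimeComplexity.coNTime (fun n => n) ∧
    wordProblem Δ ∈ TimeComplexity.NTime (fun n => n ^ 2) ∧
    wordProblem Δ ∈ TimeComplexity.DTime (fun n => n ^ 3) := by
  have hf (a : Δ × Bool) := (letterValue a)⁻¹.isFGEssentialIso
  have h : wordProblem Δ =
      Thompson.identityWords fun a : Δ × Bool => (letterValue a)⁻¹.toPEquiv :=
    Set.ext fun w => Thompson.mem_wordProblem_iff Δ w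
  rw [h]
  -- The same quadratic-time deterministic machine serves for the last two claims.
  obtain ⟨M, C, hM, hC, hL⟩ := Thompson.exists_deterministic_machine hf
  refine ⟨Thompson.compl_identityWords_mem_nTime hf, ⟨M, C, hC, hL⟩, M, C, hM,
    fun w t c hc => (hC w t c hc).trans ?_, hL⟩
  have : w.length ^ 2 ≤ w.length ^ 3 := by
    rcases Nat.eq_zero_or_pos w.length with h | h
    · simp [h]
    · exact Nat.pow_le_pow_right h (by norm_num)
  exact Nat.add_le_add_right (Nat.mul_le_mul_left C this) C
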